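/- A Boolean circuit in negation normal form has literals as inputs and $\wedge$- and $\vee$-gates of arbitrary fan-in; its size is its number of gates (inputs included). It is a deterministic DNNF if the subcircuits rooted in any two inputs of an $\wedge$-gate have disjoint variable sets, and no assignment makes two inputs of an $\vee$-gate true. An FBDD is a binary decision diagram (a directed acyclic graph with one source and two sinks labeled $0$ and $1$, whose other nodes are labeled with variables and have one outgoing $0$-edge and one outgoing $1$-edge) in which every variable appears at most once on every source-sink path; its size is its number of nodes. It is layered of width at most $w$ if its nodes can be partitioned into $L_1,\dots,L_s$ with $|L_i|\le w$ for all $i$ such that every edge goes from some $L_i$ to $L_{i+1}$. **Lemma.** There are constants $C, W, n_0\in\mathbb{N}$ and $c>0$ such that for every $n\ge 1$ there are a Boolean function $f_n$ on at most $Cn^2$ variables and a variable $x$ of $f_n$ such that 1. $f_n$ is computed by a layered FBDD of size at most $Cn^2$ and width at most $W$, and 2. if $n\ge n_0$, then every deterministic DNNF computing $\exists x\, f_n$ has size at least $2^{cn}$. -/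

import Mathlib

/-- The Boolean function `∃ x f`. It is written as a function of all variables of `f`; its value
does not depend on `x`. -/
def existsVar {V : Type*} [DecidableEq V] (x : V) (f : (V → Bool) → Bool) : (V → Bool) → Bool :=
  fun a => f (Function.update a x false) || f (Function.update a x true)

/-- Labels of the gates of a circuit in negation normal form with variables in `V` and gates in `G`:
a literal (`lit x true` is `x`, `lit x false` is `¬ x`), or an `∧`- or `∨`-gate of arbitrary fan-in
with its set of inputs. The constants `1` and `0` are the gates `and ∅` and `or ∅`. -/
inductive NNFLabel (V G : Type*) where
  | lit (x : V) (b : Bool)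
  | and (s : Finset G)
  | or (s : Finset G)

/-- The inputs of a gate with a given label. -/
def NNFLabel.inputs {V G : Type*} : NNFLabel V G → Finset G
  | .lit _ _ => ∅
  | .and s => s
  | .or s => s

/-- A Boolean circuit in negation normal form: a finite directed acyclic graph of gates with a
designated output gate. (On a finite set, acyclicity is well-foundedness of the input relation.) -/
structure NNF (V : Type*) where
  Gate : Type
  fintypeGate : Fintype Gate
  label : Gate → NNFLabel V Gate
  output : Gate
  acyclic : WellFounded fun h g : Gate => h ∈ (label g).inputs

namespace NNF

variable {V : Type*} (D : NNF V)

/-- `D.IsInput h g`: the gate `h` is an input (a child) of the gate `g`. -/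
def IsInput (h g : D.Gate) : Prop := h ∈ (D.label g).inputs

/-- The size of a circuit is the number of its gates, input gates included. -/
def size : ℕ := @Fintype.card D.Gate D.fintypeGate

/-- One evaluation step: the truth value of a gate with label `l`, given those of its inputs. -/
def stepTrue {G : Type} (a : V → Bool) (l : NNFLabel V G) (r : ∀ h, h ∈ l.inputs → Prop) : Prop :=
  match l, r with
  | .lit x b, _ => a x = b
  | .and _, r => ∀ h hh, r h hh
  | .or _, r => ∃ h hh, r h hh

/-- `D.GateTrue a g`: the gate `g` evaluates to true under the assignment `a`. -/
def GateTrue (a : V → Bool) : D.Gate → Prop :=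
  D.acyclic.fix fun g r => stepTrue a (D.label g) r

theorem gateTrue_eq (a : V → Bool) (g : D.Gate) :
    D.GateTrue a g = stepTrue a (D.label g) (fun h _ => D.GateTrue a h) :=
  D.acyclic.fix_eq _ g

theorem gateTrue_lit {a : V → Bool} {g : D.Gate} {x : V} {b : Bool}
    (hg : D.label g = .lit x b) : D.GateTrue a g ↔ a x = b := by
  rw [gateTrue_eq, hg]; rfl

theorem gateTrue_and {a : V → Bool} {g : D.Gate} {s : Finset D.Gate}
    (hg : D.label g = .and s) : D.GateTrue a g ↔ ∀ h ∈ s, D.GateTrue a h := by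
  rw [gateTrue_eq, hg]; rfl

theorem gateTrue_or {a : V → Bool} {g : D.Gate} {s : Finset D.Gate}
    (hg : D.label g = .or s) : D.GateTrue a g ↔ ∃ h ∈ s, D.GateTrue a h := by
  rw [gateTrue_eq, hg]; exact ⟨fun ⟨h, hh, t⟩ => ⟨h, hh, t⟩, fun ⟨h, hh, t⟩ => ⟨h, hh, t⟩⟩

/-- The circuit computes the Boolean function `f`. -/
def Computes (f : (V → Bool) → Bool) : Prop :=
  ∀ a, D.GateTrue a D.output ↔ f a = true

/-- The set of variables of the subcircuit rooted in the gate `g`. -/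
def vars (g : D.Gate) : Set V :=
  {x | ∃ h b, Relation.ReflTransGen D.IsInput h g ∧ D.label h = .lit x b}

/-- The subcircuits rooted in two different inputs of an `∧`-gate have disjoint variable sets. A
circuit with this property is a DNNF. -/
def IsDecomposable : Prop :=
  ∀ g s, D.label g = .and s → ∀ h₁ ∈ s, ∀ h₂ ∈ s, h₁ ≠ h₂ → Disjoint (D.vars h₁) (D.vars h₂)

/-- No assignment makes two different inputs of an `∨`-gate true. -/
def IsDeterministic : Prop :=
  ∀ g s, D.label g = .or s → ∀ h₁ ∈ s, ∀ h₂ ∈ s, h₁ ≠ h₂ →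
    ∀ a : V → Bool, ¬ (D.GateTrue a h₁ ∧ D.GateTrue a h₂)

/-- A deterministic DNNF (d-DNNF). -/
def IsDDNNF : Prop := D.IsDecomposable ∧ D.IsDeterministic

end NNF

/-- A binary decision diagram with variables in `V`. Its nodes are the decision nodes `.inl u`, each
with a variable and an outgoing edge for each value `b` of it, and the two sinks `.inr b`, labeled
with `b`. The graph is acyclic, and `source` is its only node without incoming edges. -/
structure BDD (V : Type*) where
  Decision : Type
  fintypeDecision : Fintype Decision
  var : Decision → V
  succ : Decision → Bool → Decision ⊕ Bool
  source : Decision ⊕ Bool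
  acyclic : WellFounded fun v u : Decision ⊕ Bool => ∃ d b, u = .inl d ∧ v = succ d b
  source_iff : ∀ v, v = source ↔ ¬ ∃ d b, v = succ d b

namespace BDD

variable {V : Type*} (B : BDD V)

/-- All nodes: decision nodes and sinks. -/
abbrev Node : Type := B.Decision ⊕ Bool

/-- There is an edge from `u` to `v`. -/
def Edge (u v : B.Node) : Prop := ∃ d b, u = .inl d ∧ v = B.succ d b

/-- The size of a BDD is the number of its nodes (there are two sinks). -/
def size : ℕ := @Fintype.card B.Decision B.fintypeDecision + 2

/-- The label of the sink that is reached from a node under the assignment `a`. -/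
def evalFrom (a : V → Bool) : B.Node → Bool :=
  B.acyclic.fix fun u r =>
    match u, r with
    | .inr b, _ => b
    | .inl d, r => r (B.succ d (a (B.var d))) ⟨d, _, rfl, rfl⟩

theorem evalFrom_sink (a : V → Bool) (b : Bool) : B.evalFrom a (.inr b) = b :=
  B.acyclic.fix_eq _ _

theorem evalFrom_decision (a : V → Bool) (d : B.Decision) :
    B.evalFrom a (.inl d) = B.evalFrom a (B.succ d (a (B.var d))) :=
  B.acyclic.fix_eq _ _

/-- The BDD computes the Boolean function `f`. -/
def Computes (f : (V → Bool) → Bool) : Prop :=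
  ∀ a, B.evalFrom a B.source = f a

/-- `p` is the list of nodes of a directed path from the source to a sink. -/
def IsSourceSinkPath (p : List B.Node) : Prop :=
  p.IsChain B.Edge ∧ p.head? = some B.source ∧ ∃ b, p.getLast? = some (.inr b)

/-- The variable of a node, if it is a decision node. -/
def nodeVar? (u : B.Node) : Option V := u.getLeft?.map B.var

/-- The BDD is free (an FBDD): on every source-sink path every variable appears at most once. -/
def IsFree : Prop :=
  ∀ p, B.IsSourceSinkPath p → (p.filterMap B.nodeVar?).Nodup

/-- The BDD is layered with width at most `w`: its nodes are partitioned into layers, the edges go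
from each layer to the next one only, and every layer has at most `w` nodes. -/
def IsLayeredOfWidthLE (w : ℕ) : Prop :=
  ∃ layer : B.Node → ℕ,
    (∀ u v, B.Edge u v → layer v = layer u + 1) ∧ ∀ i, {u | layer u = i}.ncard ≤ w

end BDD

/-! The function lives on a `K × K` grid of variables with `K = n + 1`, plus a selector `x`. The
selector decides whether the value is the F₂-quadratic form of the row paths (sum of products of
horizontally adjacent cells) or that of the column paths. Either form can be evaluated in its own
reading order with constantly many states, which gives the narrow FBDD. Quantifying `x` yields "row
form or column form", for which no single order serves.

Lower bound: a deterministic DNNF splits its models into at most size² rectangles with balanced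
partitions (`NNF.IsDDNNF.exists_partition`). Let `r` and `s` be the signs of the two forms. Their
product is the sign of the form of the whole grid graph. For every balanced partition, some
direction has about a third of its lines containing cells of both sides
(`exists_isMixedLine_of_isBalanced`). Such lines supply an induced matching across the partition, so
`r * s` nearly cancels on every rectangle (`abs_sum_gridSign_le`).

On the other hand, four times the indicator of the models times `r * s` equals `3 * r * s - r - s -
1` (`existsVar_gridFun_mul`). Over the cube, the first three terms nearly cancel while the constant
contributes minus the number of assignments. A sum this large cannot be assembled from few
rectangles. -/

/-! ### Balanced sets of variables -/

/-- `S` is a combinatorial rectangle with respect to the partition of the variables into `Y` and its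
complement. -/
def IsRectangle {V : Type*} [DecidableEq V] (Y : Finset V) (S : Set (V → Bool)) : Prop :=
  ∀ a ∈ S, ∀ b ∈ S, Y.piecewise a b ∈ S

/-- A set of variables containing at least one third and at most two thirds of all variables. -/
def IsBalanced {V : Type*} [Fintype V] (Y : Finset V) : Prop :=
  Fintype.card V ≤ 3 * Y.card ∧ 3 * Y.card ≤ 2 * Fintype.card V

/-- The cardinality aimed at is the larger of `A.card` and a third of the variables, rounded up.
With at least two variables, the rounding does not exceed two thirds. -/
theorem exists_isBalanced_between {V : Type*} [Fintype V] [DecidableEq V]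
    (hV : 2 ≤ Fintype.card V) {A B : Finset V} (hAB : A ⊆ B)
    (hA : 3 * A.card ≤ 2 * Fintype.card V) (hB : 2 * Fintype.card V ≤ 3 * B.card) :
    ∃ Y, A ⊆ Y ∧ Y ⊆ B ∧ IsBalanced Y := by
  obtain ⟨Y, h1, h2, h3⟩ := Finset.exists_subsuperset_card_eq hAB
    (n := max A.card ((Fintype.card V + 2) / 3)) (le_max_left _ _)
    (max_le (Finset.card_le_card hAB) (by omega))
  refine ⟨Y, h1, h2, ?_, ?_⟩ <;> omega

/-- Greedy grouping: if neither the earlier union nor the new set reaches one third, their union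
stays below two thirds. -/
theorem exists_isBalanced_biUnion {V ι : Type*} [Fintype V] [DecidableEq V] [DecidableEq ι]
    (A : ι → Finset V) (s : Finset ι)
    (hA : ∀ i ∈ s, 3 * (A i).card ≤ 2 * Fintype.card V)
    (hs : Fintype.card V ≤ 3 * (s.biUnion A).card) :
    ∃ t ⊆ s, IsBalanced (t.biUnion A) := by
  induction s using Finset.induction_on with
  | empty => exact ⟨∅, subset_rfl, hs, by simp⟩
  | insert i s hi ih =>
    by_cases h1 : Fintype.card V ≤ 3 * (s.biUnion A).card
    · obtain ⟨t, ht, hb⟩ := ih (fun j hj => hA j (Finset.mem_insert_of_mem hj)) h1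
      exact ⟨t, ht.trans (Finset.subset_insert _ _), hb⟩
    by_cases h2 : Fintype.card V ≤ 3 * (A i).card
    · refine ⟨{i}, by simp, ?_, ?_⟩
      · simpa using h2
      · simpa using hA i (Finset.mem_insert_self _ _)
    · refine ⟨insert i s, subset_rfl, hs, ?_⟩
      rw [Finset.biUnion_insert]
      have := Finset.card_union_le (A i) (s.biUnion A)
      omega

/-! ### From deterministic DNNFs to partitions into balanced rectangles -/

namespace NNF

variable {V : Type*} (D : NNF V)

theorem vars_subset {g h : D.Gate} (hh : D.IsInput h g) : D.vars h ⊆ D.vars g :=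
  fun _ ⟨k, b, hk, hl⟩ => ⟨k, b, hk.tail hh, hl⟩

theorem vars_lit {g : D.Gate} {x : V} {b : Bool} (hg : D.label g = .lit x b) :
    D.vars g = {x} := by
  ext y
  constructor
  · rintro ⟨h, c, hr, hl⟩
    rcases Relation.ReflTransGen.cases_tail hr with rfl | ⟨k, -, hk⟩
    · rw [hg] at hl
      cases hl
      rfl
    · simp [IsInput, hg, NNFLabel.inputs] at hk
  · rintro rfl
    exact ⟨g, b, .refl, hg⟩

theorem exists_input_of_mem_vars {g : D.Gate} {s : Finset D.Gate}
    (hg : D.label g = .and s) {x : V} (hx : x ∈ D.vars g) : ∃ h ∈ s, x ∈ D.vars h := by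
  obtain ⟨h, c, hr, hl⟩ := hx
  rcases Relation.ReflTransGen.cases_tail hr with rfl | ⟨k, hk', hk⟩
  · rw [hg] at hl
    cases hl
  · refine ⟨k, ?_, h, c, hk', hl⟩
    simpa [IsInput, hg, NNFLabel.inputs] using hk

theorem isInput_and {g h : D.Gate} {s : Finset D.Gate} (hg : D.label g = .and s) :
    D.IsInput h g ↔ h ∈ s := by
  simp [IsInput, hg, NNFLabel.inputs]

theorem isInput_or {g h : D.Gate} {s : Finset D.Gate} (hg : D.label g = .or s) :
    D.IsInput h g ↔ h ∈ s := by
  simp [IsInput, hg, NNFLabel.inputs]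

theorem gateTrue_congr {a b : V → Bool} (g : D.Gate) (hab : ∀ x ∈ D.vars g, a x = b x) :
    D.GateTrue a g ↔ D.GateTrue b g := by
  induction g using D.acyclic.induction with
  | _ g ih =>
    have ih' : ∀ h, D.IsInput h g → (D.GateTrue a h ↔ D.GateTrue b h) := fun h hh =>
      ih h hh fun x hx => hab x (D.vars_subset hh hx)
    cases hg : D.label g with
    | lit x c =>
      rw [D.gateTrue_lit hg, D.gateTrue_lit hg, hab x (by simp [D.vars_lit hg])]
    | and s =>
      rw [D.gateTrue_and hg, D.gateTrue_and hg]
      exact forall₂_congr fun h hh => ih' h ((D.isInput_and hg).2 hh)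
    | or s =>
      rw [D.gateTrue_or hg, D.gateTrue_or hg]
      exact exists_congr fun h => and_congr_right fun hh => ih' h ((D.isInput_or hg).2 hh)

variable [Fintype V]

open Classical in
/-- The set of variables of the subcircuit rooted in a gate, as a finite set. -/
noncomputable def varFinset (g : D.Gate) : Finset V := (D.vars g).toFinset

theorem mem_varFinset {g : D.Gate} {x : V} : x ∈ D.varFinset g ↔ x ∈ D.vars g := by
  simp [varFinset]

/-- A gate whose subcircuit contains more than two thirds of all variables. -/
def IsHeavy (g : D.Gate) : Prop := 2 * Fintype.card V < 3 * (D.varFinset g).card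

/-- Under the assignment `a`, the gates `g` and `h` are true and `h` is a heavy input of `g`. -/
def HeavyStep (a : V → Bool) (g h : D.Gate) : Prop :=
  D.GateTrue a g ∧ D.GateTrue a h ∧ D.IsInput h g ∧ D.IsHeavy h

/-- The gate `g` is true and is reached from the output through true heavy gates. -/
def HeavyReach (a : V → Bool) (g : D.Gate) : Prop :=
  D.GateTrue a D.output ∧ Relation.ReflTransGen (D.HeavyStep a) D.output g

variable {D}

theorem HeavyReach.gateTrue {a : V → Bool} {g : D.Gate} (h : D.HeavyReach a g) :
    D.GateTrue a g := by
  rcases Relation.ReflTransGen.cases_tail h.2 with h' | ⟨_, -, h'⟩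
  · exact h' ▸ h.1
  · exact h'.2.1

theorem HeavyReach.isHeavy {a : V → Bool} {g : D.Gate} (ho : D.IsHeavy D.output)
    (h : D.HeavyReach a g) : D.IsHeavy g := by
  rcases Relation.ReflTransGen.cases_tail h.2 with h' | ⟨_, -, h'⟩
  · exact h' ▸ ho
  · exact h'.2.2.2

/-- Two disjoint sets cannot both contain more than two thirds of the variables. -/
theorem IsDecomposable.eq_of_isHeavy (hD : D.IsDecomposable) {g h₁ h₂ : D.Gate}
    {s : Finset D.Gate} (hg : D.label g = .and s) (m₁ : h₁ ∈ s) (m₂ : h₂ ∈ s)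
    (H₁ : D.IsHeavy h₁) (H₂ : D.IsHeavy h₂) : h₁ = h₂ := by
  classical
  by_contra hne
  have hd : Disjoint (D.varFinset h₁) (D.varFinset h₂) := by
    rw [Finset.disjoint_left]
    intro x hx hx'
    exact Set.disjoint_left.1 (hD g s hg h₁ m₁ h₂ m₂ hne) (D.mem_varFinset.1 hx)
      (D.mem_varFinset.1 hx')
  have h := (D.varFinset h₁ ∪ D.varFinset h₂).card_le_univ
  rw [Finset.card_union_of_disjoint hd] at h
  unfold IsHeavy at H₁ H₂
  omega

/-- Decomposability leaves at most one heavy input at an `∧`-gate, and determinism at most one true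
input at an `∨`-gate. Hence each model determines its walk, which is what makes the later cover
disjoint. -/
theorem IsDDNNF.rightUnique_heavyStep (hD : D.IsDDNNF) (a : V → Bool) :
    Relator.RightUnique (D.HeavyStep a) := by
  rintro g h₁ h₂ ⟨-, t₁, i₁, H₁⟩ ⟨-, t₂, i₂, H₂⟩
  cases hg : D.label g with
  | lit x b => simp [IsInput, hg, NNFLabel.inputs] at i₁
  | and s =>
    rw [D.isInput_and hg] at i₁ i₂
    exact hD.1.eq_of_isHeavy hg i₁ i₂ H₁ H₂
  | or s =>
    rw [D.isInput_or hg] at i₁ i₂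
    by_contra hne
    exact hD.2 g s hg h₁ i₁ h₂ i₂ hne a ⟨t₁, t₂⟩

/-- Whether `g` is reached depends, for assignments that make `g` true, only on the values of the
variables outside the subcircuit of `g`. -/
theorem IsDecomposable.heavyReach_congr (hD : D.IsDecomposable) {b c : V → Bool} {g : D.Gate}
    (hb : D.HeavyReach b g) (hc : D.GateTrue c g) (hbc : ∀ x ∉ D.vars g, c x = b x) :
    D.HeavyReach c g := by
  obtain ⟨ho, hr⟩ := hb
  -- Truth is propagated back up the walk: at an `∧`-gate, the siblings of `h` share no variable
  -- with `h` and keep their value under `b`; at an `∨`-gate, the truth of `h` suffices.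
  induction hr generalizing c with
  | refl => exact ⟨hc, .refl⟩
  | @tail g h _ hs ih =>
    obtain ⟨tg, th, hi, hh⟩ := hs
    have hcg : D.GateTrue c g := by
      cases hg : D.label g with
      | lit x b => simp [IsInput, hg, NNFLabel.inputs] at hi
      | and s =>
        rw [D.gateTrue_and hg] at tg ⊢
        intro k hk
        by_cases hkh : k = h
        · exact hkh ▸ hc
        · rw [D.gateTrue_congr (b := b) k]
          · exact tg k hk
          · intro x hx
            refine hbc x fun hx' => ?_
            exact Set.disjoint_left.1
              (hD g s hg k hk h ((D.isInput_and hg).1 hi) hkh) hx hx'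
      | or s =>
        exact (D.gateTrue_or hg).2 ⟨h, (D.isInput_or hg).1 hi, hc⟩
    have hcr := ih hcg fun x hx => hbc x fun hx' => hx (D.vars_subset hi hx')
    exact ⟨hcr.1, hcr.2.tail ⟨hcg, hc, hi, hh⟩⟩

variable (D) in
/-- The walk through true heavy gates ends in `g`: either `g` is an `∨`-gate and `h` is its true
input, which is not heavy, or `g = h` is an `∧`-gate without heavy inputs. -/
def HeavyEnd (a : V → Bool) (g h : D.Gate) : Prop :=
  D.HeavyReach a g ∧
    ((∃ s, D.label g = .or s ∧ h ∈ s ∧ D.GateTrue a h ∧ ¬ D.IsHeavy h) ∨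
      (∃ s, D.label g = .and s ∧ h = g ∧ ∀ k ∈ s, ¬ D.IsHeavy k))

theorem HeavyEnd.not_heavyStep (hD : D.IsDDNNF) {a : V → Bool} {g h k : D.Gate}
    (he : D.HeavyEnd a g h) : ¬ D.HeavyStep a g k := by
  rintro ⟨-, tk, hi, hk⟩
  rcases he with ⟨-, ⟨s, hg, hs, th, hh⟩ | ⟨s, hg, -, hs⟩⟩
  · rw [D.isInput_or hg] at hi
    by_cases hkh : k = h
    · exact hh (hkh ▸ hk)
    · exact hD.2 g s hg k hi h hs hkh a ⟨tk, th⟩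
  · exact hs k ((D.isInput_and hg).1 hi) hk

/-- Two walks along a right-unique relation from the same gate are comparable, and neither continues
past its end. At a final `∨`-gate, determinism fixes `h`. -/
theorem HeavyEnd.unique (hD : D.IsDDNNF) {a : V → Bool} {g h g' h' : D.Gate}
    (he : D.HeavyEnd a g h) (he' : D.HeavyEnd a g' h') : g = g' ∧ h = h' := by
  have hgg : g = g' := by
    rcases Relation.ReflTransGen.total_of_right_unique (hD.rightUnique_heavyStep a)
      he.1.2 he'.1.2 with hr | hr
    · rcases Relation.ReflTransGen.cases_head hr with h | ⟨k, hk, -⟩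
      · exact h
      · exact absurd hk (he.not_heavyStep hD)
    · rcases Relation.ReflTransGen.cases_head hr with h | ⟨k, hk, -⟩
      · exact h.symm
      · exact absurd hk (he'.not_heavyStep hD)
  subst hgg
  refine ⟨rfl, ?_⟩
  rcases he with ⟨-, ⟨s, hg, hs, th, -⟩ | ⟨s, hg, rfl, -⟩⟩ <;>
  rcases he' with ⟨-, ⟨s', hg', hs', th', -⟩ | ⟨s', hg', rfl, -⟩⟩
  · rw [hg] at hg'
    cases hg'
    by_contra hne
    exact hD.2 g s hg h hs h' hs' hne a ⟨th, th'⟩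
  · rw [hg] at hg'
    cases hg'
  · rw [hg] at hg'
    cases hg'
  · rfl

theorem IsHeavy.label_ne_lit (hV : 2 ≤ Fintype.card V) {g : D.Gate} (hg : D.IsHeavy g) (x : V)
    (b : Bool) : D.label g ≠ .lit x b := by
  intro hl
  have h : D.varFinset g = {x} := by
    ext y
    rw [D.mem_varFinset, D.vars_lit hl]
    simp
  unfold IsHeavy at hg
  rw [h, Finset.card_singleton] at hg
  omega

theorem exists_heavyEnd (hV : 2 ≤ Fintype.card V) (ho : D.IsHeavy D.output) {a : V → Bool}
    (ha : D.GateTrue a D.output) : ∃ g h, D.HeavyEnd a g h := by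
  obtain ⟨g, hg, hmin⟩ := D.acyclic.has_min {g | D.HeavyReach a g} ⟨D.output, ha, .refl⟩
  have hlast : ∀ h, D.IsInput h g → D.GateTrue a h → ¬ D.IsHeavy h := fun h hi ht hh =>
    hmin h ⟨hg.1, hg.2.tail ⟨hg.gateTrue, ht, hi, hh⟩⟩ hi
  have tg := hg.gateTrue
  cases hl : D.label g with
  | lit x b => exact absurd hl ((hg.isHeavy ho).label_ne_lit hV x b)
  | and s =>
    refine ⟨g, g, hg, .inr ⟨s, hl, rfl, fun k hk => ?_⟩⟩
    exact hlast k ((D.isInput_and hl).2 hk) ((D.gateTrue_and hl).1 tg k hk)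
  | or s =>
    obtain ⟨h, hs, ht⟩ := (D.gateTrue_or hl).1 tg
    exact ⟨g, h, hg, .inl ⟨s, hl, hs, ht, hlast h ((D.isInput_or hl).2 hs) ht⟩⟩

variable [DecidableEq V]

/-- At an `∨`-end, `Y` lies between the variables of the light input `h` and those of `g`: the part
in `Y` keeps `h` true, and the part outside controls the walk to `g`. At an `∧`-end, `Y` collects
the variables of a group of light inputs: inputs in the group follow `a`, the others follow `b`, and
so does the walk. -/
theorem IsDDNNF.exists_isRectangle_heavyEnd (hD : D.IsDDNNF) (hV : 2 ≤ Fintype.card V)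
    (ho : D.IsHeavy D.output) (g h : D.Gate) :
    ∃ Y, IsBalanced Y ∧ IsRectangle Y {a | D.HeavyEnd a g h} := by
  classical
  rcases Set.eq_empty_or_nonempty {a | D.HeavyEnd a g h} with he | ⟨a₀, hr₀, hcase⟩
  · obtain ⟨Y, -, -, hY⟩ := exists_isBalanced_between hV (Finset.empty_subset Finset.univ)
      (by simp) (by rw [Finset.card_univ]; omega)
    exact ⟨Y, hY, by rw [he]; rintro _ ⟨⟩⟩
  have hheavy : 2 * Fintype.card V < 3 * (D.varFinset g).card := hr₀.isHeavy ho
  rcases hcase with ⟨s, hg, hs, -, hh⟩ | ⟨s, hg, rfl, hs⟩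
  · have hi : D.IsInput h g := (D.isInput_or hg).2 hs
    obtain ⟨Y, hY₁, hY₂, hY⟩ := exists_isBalanced_between hV
      (A := D.varFinset h) (B := D.varFinset g)
      (fun x hx => D.mem_varFinset.2 (D.vars_subset hi (D.mem_varFinset.1 hx)))
      (not_lt.1 hh) hheavy.le
    refine ⟨Y, hY, ?_⟩
    rintro a ⟨-, hca⟩ b ⟨hrb, -⟩
    have tah : D.GateTrue a h := by
      rcases hca with ⟨_, -, -, t, -⟩ | ⟨s', hg', -⟩
      · exact t
      · rw [hg] at hg'
        cases hg'
    have th : D.GateTrue (Y.piecewise a b) h := by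
      rw [D.gateTrue_congr (b := a) h]
      · exact tah
      · intro x hx
        exact Finset.piecewise_eq_of_mem _ _ _ (hY₁ (D.mem_varFinset.2 hx))
    refine ⟨hD.1.heavyReach_congr hrb ((D.gateTrue_or hg).2 ⟨h, hs, th⟩) fun x hx => ?_,
      .inl ⟨s, hg, hs, th, hh⟩⟩
    exact Finset.piecewise_eq_of_notMem _ _ _ fun hx' => hx (D.mem_varFinset.1 (hY₂ hx'))
  · have hun : s.biUnion D.varFinset = D.varFinset h := by
      ext x
      simp only [Finset.mem_biUnion, D.mem_varFinset]
      exact ⟨fun ⟨k, hk, hx⟩ => D.vars_subset ((D.isInput_and hg).2 hk) hx,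
        D.exists_input_of_mem_vars hg⟩
    obtain ⟨t, hts, hY⟩ := exists_isBalanced_biUnion D.varFinset s
      (fun k hk => not_lt.1 (hs k hk)) (by rw [hun]; omega)
    refine ⟨_, hY, ?_⟩
    rintro a ⟨hra, -⟩ b ⟨hrb, -⟩
    have ta := (D.gateTrue_and hg).1 hra.gateTrue
    have tb := (D.gateTrue_and hg).1 hrb.gateTrue
    refine ⟨hD.1.heavyReach_congr hrb ((D.gateTrue_and hg).2 fun k hk => ?_) fun x hx => ?_,
      .inr ⟨s, hg, rfl, hs⟩⟩
    · by_cases hkt : k ∈ t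
      · rw [D.gateTrue_congr (b := a) k]
        · exact ta k hk
        · intro x hx
          exact Finset.piecewise_eq_of_mem _ _ _
            (Finset.mem_biUnion.2 ⟨k, hkt, D.mem_varFinset.2 hx⟩)
      · rw [D.gateTrue_congr (b := b) k]
        · exact tb k hk
        · intro x hx
          refine Finset.piecewise_eq_of_notMem _ _ _ fun hx' => ?_
          obtain ⟨k', hk', hx''⟩ := Finset.mem_biUnion.1 hx'
          exact Set.disjoint_left.1 (hD.1 h s hg k hk k' (hts hk') fun e => hkt (e ▸ hk')) hx
            (D.mem_varFinset.1 hx'')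
    · refine Finset.piecewise_eq_of_notMem _ _ _ fun hx' => hx ?_
      rw [← D.mem_varFinset, ← hun]
      exact Finset.biUnion_subset_biUnion_of_subset_left _ hts hx'

/-- The models of a deterministic DNNF are partitioned into at most quadratically many balanced
rectangles. -/
theorem IsDDNNF.exists_partition (hD : D.IsDDNNF) (hV : 2 ≤ Fintype.card V) :
    ∃ S : D.Gate × D.Gate → Set (V → Bool),
      (∀ t, ∃ Y, IsBalanced Y ∧ IsRectangle Y (S t)) ∧
      (∀ a, D.GateTrue a D.output → ∃! t, a ∈ S t) ∧
      (∀ a t, a ∈ S t → D.GateTrue a D.output) := by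
  by_cases ho : D.IsHeavy D.output
  · refine ⟨fun t => {a | D.HeavyEnd a t.1 t.2},
      fun t => hD.exists_isRectangle_heavyEnd hV ho t.1 t.2, fun a ha => ?_, fun a t h => h.1.1⟩
    obtain ⟨g, h, he⟩ := exists_heavyEnd hV ho ha
    refine ⟨(g, h), he, fun t ht => ?_⟩
    obtain ⟨h₁, h₂⟩ := HeavyEnd.unique hD ht he
    exact Prod.ext h₁ h₂
  -- If the output is light, one balanced `Y` contains all variables of the circuit. The set of all
  -- models is then a single rectangle, and the other indices get the empty set.
  · obtain ⟨Y, hY₁, -, hY⟩ := exists_isBalanced_between hV (Finset.subset_univ (D.varFinset D.output))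
      (not_lt.1 ho) (by rw [Finset.card_univ]; omega)
    refine ⟨fun t => {a | D.GateTrue a D.output ∧ t = (D.output, D.output)},
      fun t => ⟨Y, hY, ?_⟩, fun a ha => ⟨_, ⟨ha, rfl⟩, fun t ht => ht.2⟩, fun a t h => h.1⟩
    rintro a ⟨ha, ht⟩ b -
    refine ⟨?_, ht⟩
    rw [D.gateTrue_congr (b := a)]
    · exact ha
    · intro x hx
      exact Finset.piecewise_eq_of_mem _ _ _ (hY₁ (D.mem_varFinset.2 hx))

end NNF

/-! ### Discrepancy of quadratic forms on rectangles -/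

section Discrepancy

variable {V : Type*} [DecidableEq V]

/-- The assignment `a` with the value of `u` flipped. -/
def flipVar (u : V) (a : V → Bool) : V → Bool := Function.update a u (!a u)

theorem flipVar_involutive (u : V) : Function.Involutive (flipVar u) := by
  intro a
  simp [flipVar]

theorem piecewise_flipVar {Y : Finset V} {u : V} (hu : u ∈ Y) (a b : V → Bool) :
    Y.piecewise (flipVar u a) b = flipVar u (Y.piecewise a b) := by
  ext x
  by_cases hx : x = u
  · subst hx
    simp [flipVar, hu]
  · by_cases hY : x ∈ Y <;> simp [flipVar, hx, hY]

variable [Fintype V]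

/-- Exchanging the `Y`-parts and complementary parts of a pair is a bijection. It allows both sides
of the partition to be indexed by full assignments, at the cost of a factor `2 ^ Fintype.card V`. -/
theorem sum_piecewise (Y : Finset V) (F : (V → Bool) → ℝ) :
    ∑ a, ∑ b, F (Y.piecewise a b) = 2 ^ Fintype.card V * ∑ a, F a := by
  have hinv : Function.Involutive fun p : (V → Bool) × (V → Bool) =>
      (Y.piecewise p.1 p.2, Y.piecewise p.2 p.1) := by
    rintro ⟨a, b⟩
    refine Prod.ext ?_ ?_ <;> (ext x; by_cases hx : x ∈ Y <;> simp [hx])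
  rw [← Fintype.sum_prod_type' fun a b => F (Y.piecewise a b)]
  have h := Equiv.sum_comp hinv.toPerm fun p : (V → Bool) × (V → Bool) => F p.1
  refine Eq.trans h ?_
  rw [Fintype.sum_prod_type]
  simp [Finset.mul_sum]

/-- Cauchy–Schwarz bound for the sum of `φ` over a rectangle. -/
theorem sq_sum_rectangle_le (Y : Finset V) (S : Set (V → Bool)) [DecidablePred (· ∈ S)]
    (hS : IsRectangle Y S) (φ : (V → Bool) → ℝ) :
    2 ^ Fintype.card V * (∑ a with a ∈ S, φ a) ^ 2 ≤
      ∑ b, ∑ b', |∑ a, φ (Y.piecewise a b) * φ (Y.piecewise a b')| := by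
  classical
  -- `A` and `B` indicate the projections of `S` to the two sides; for a rectangle their product
  -- indicates `S`.
  set A : (V → Bool) → ℝ := fun a => if ∃ b, Y.piecewise a b ∈ S then 1 else 0 with hA
  set B : (V → Bool) → ℝ := fun b => if ∃ a, Y.piecewise a b ∈ S then 1 else 0 with hB
  have hAB : ∀ a b, (if Y.piecewise a b ∈ S then φ (Y.piecewise a b) else 0) =
      A a * (B b * φ (Y.piecewise a b)) := by
    intro a b
    by_cases h : Y.piecewise a b ∈ S
    · have h1 : ∃ b, Y.piecewise a b ∈ S := ⟨b, h⟩
      have h2 : ∃ a, Y.piecewise a b ∈ S := ⟨a, h⟩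
      simp only [hA, hB, if_pos h, if_pos h1, if_pos h2, one_mul]
    · rw [if_neg h]
      by_cases h1 : ∃ b, Y.piecewise a b ∈ S
      · by_cases h2 : ∃ a, Y.piecewise a b ∈ S
        · obtain ⟨b', hb'⟩ := h1
          obtain ⟨a', ha'⟩ := h2
          refine absurd ?_ h
          have := hS _ hb' _ ha'
          simpa using this
        · simp only [hB, if_neg h2]
          ring
      · simp only [hA, if_neg h1]
        ring
  have hA1 : ∀ a, A a ^ 2 ≤ 1 := by
    intro a
    simp only [hA]
    split_ifs <;> norm_num
  have hB1 : ∀ b, |B b| ≤ 1 := by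
    intro b
    simp only [hB]
    split_ifs <;> norm_num
  have hsum : 2 ^ Fintype.card V * ∑ a with a ∈ S, φ a =
      ∑ a, A a * ∑ b, B b * φ (Y.piecewise a b) := by
    rw [Finset.sum_filter, ← sum_piecewise Y fun a => if a ∈ S then φ a else 0]
    simp only [hAB, Finset.mul_sum]
  have hcs := Finset.sum_mul_sq_le_sq_mul_sq Finset.univ A
    fun a => ∑ b, B b * φ (Y.piecewise a b)
  rw [← hsum] at hcs
  have hA2 : ∑ a, A a ^ 2 ≤ 2 ^ Fintype.card V := by
    refine (Finset.sum_le_sum fun a _ => hA1 a).trans ?_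
    simp
  have hexp : ∑ a, (∑ b, B b * φ (Y.piecewise a b)) ^ 2 =
      ∑ b, ∑ b', (B b * B b') * ∑ a, φ (Y.piecewise a b) * φ (Y.piecewise a b') := by
    simp only [sq, Finset.sum_mul_sum]
    simp only [Finset.mul_sum]
    rw [Finset.sum_comm]
    refine Finset.sum_congr rfl fun b _ => ?_
    rw [Finset.sum_comm]
    refine Finset.sum_congr rfl fun b' _ => Finset.sum_congr rfl fun a _ => ?_
    ring
  have hle : ∑ a, (∑ b, B b * φ (Y.piecewise a b)) ^ 2 ≤
      ∑ b, ∑ b', |∑ a, φ (Y.piecewise a b) * φ (Y.piecewise a b')| := by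
    rw [hexp]
    refine Finset.sum_le_sum fun b _ => Finset.sum_le_sum fun b' _ => ?_
    refine (le_abs_self _).trans ?_
    rw [abs_mul, abs_mul]
    exact mul_le_of_le_one_left (abs_nonneg _)
      (mul_le_one₀ (hB1 b) (abs_nonneg _) (hB1 b'))
  have hpos : (0 : ℝ) < 2 ^ Fintype.card V := by positivity
  have hfin : (2 ^ Fintype.card V * ∑ a with a ∈ S, φ a) ^ 2 ≤ 2 ^ Fintype.card V *
      ∑ b, ∑ b', |∑ a, φ (Y.piecewise a b) * φ (Y.piecewise a b')| :=
    hcs.trans (mul_le_mul hA2 hle (Finset.sum_nonneg fun a _ => sq_nonneg _) hpos.le)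
  refine le_of_mul_le_mul_left ?_ hpos
  calc _ = (2 ^ Fintype.card V * ∑ a with a ∈ S, φ a) ^ 2 := by ring
    _ ≤ _ := hfin

theorem card_le_of_eq_outside (T : Finset (V → Bool)) (W : Finset V)
    (hT : ∀ b ∈ T, ∀ b' ∈ T, (∀ x ∉ W, b x = b' x) → b = b') :
    T.card * 2 ^ W.card ≤ 2 ^ Fintype.card V := by
  have h1 : T.card ≤ Fintype.card ({x // x ∉ W} → Bool) := by
    rw [← Finset.card_univ]
    refine Finset.card_le_card_of_injOn (fun b x => b x.1) (fun _ _ => Finset.mem_univ _) ?_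
    intro b hb b' hb' h
    exact hT b hb b' hb' fun x hx => congrFun h ⟨x, hx⟩
  have h2 : Fintype.card ({x // x ∉ W} → Bool) = 2 ^ (Fintype.card V - W.card) := by
    simp [Fintype.card_subtype_compl]
  rw [h2] at h1
  calc _ ≤ 2 ^ (Fintype.card V - W.card) * 2 ^ W.card := Nat.mul_le_mul_right _ h1
    _ = _ := by rw [← pow_add, Nat.sub_add_cancel W.card_le_univ]

/-- The sum of a `±1`-valued function over a rectangle is small if the function has many
derivatives `∂ φ (a) = φ (a with u flipped) φ (a)` in directions `u ∈ Y` that split as a product of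
functions of the two parts of the variables and are sensitive to private variables outside of
`Y`. -/
theorem sq_sum_rectangle_mul_le {ι : Type*} (Y : Finset V) (S : Set (V → Bool))
    [DecidablePred (· ∈ S)] (hS : IsRectangle Y S) (φ : (V → Bool) → ℝ)
    (hφ : ∀ a, φ a * φ a = 1) (L : Finset ι) (u v : ι → V) (hu : ∀ i ∈ L, u i ∈ Y)
    (hv : Set.InjOn v L) (W : Finset V) (hW : W = L.image v)
    (hsplit : ∀ i ∈ L, ∀ a a' b b',
      (φ (flipVar (u i) (Y.piecewise a b)) * φ (Y.piecewise a b)) *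
        (φ (flipVar (u i) (Y.piecewise a b')) * φ (Y.piecewise a b')) =
      (φ (flipVar (u i) (Y.piecewise a' b)) * φ (Y.piecewise a' b)) *
        (φ (flipVar (u i) (Y.piecewise a' b')) * φ (Y.piecewise a' b')))
    (hsens : ∀ i ∈ L, ∀ a b b', (∀ x ∉ W, b x = b' x) → b (v i) ≠ b' (v i) →
      φ (flipVar (u i) (Y.piecewise a b)) * φ (Y.piecewise a b) =
        -(φ (flipVar (u i) (Y.piecewise a b')) * φ (Y.piecewise a b'))) :
    (∑ a with a ∈ S, φ a) ^ 2 * 2 ^ L.card ≤ (2 ^ Fintype.card V) ^ 2 := by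
  have habs : ∀ a, |φ a| = 1 := by
    intro a
    rcases mul_self_eq_one_iff.1 (hφ a) with h | h <;> simp [h]
  have hterm : ∀ b b', |∑ a, φ (Y.piecewise a b) * φ (Y.piecewise a b')| ≤
      2 ^ Fintype.card V := by
    intro b b'
    refine (Finset.abs_sum_le_sum_abs _ _).trans ?_
    simp [abs_mul, habs]
  -- If the derivatives at `b` and `b'` differ for one `a`, their product is `-1` for all `a` by
  -- `hsplit`. Flipping `u i` then negates every summand while permuting the sum, so the sum
  -- vanishes.
  have hzero : ∀ i ∈ L, ∀ b b', ∑ a, φ (Y.piecewise a b) * φ (Y.piecewise a b') ≠ 0 → ∀ a,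
      φ (flipVar (u i) (Y.piecewise a b)) * φ (Y.piecewise a b) =
        φ (flipVar (u i) (Y.piecewise a b')) * φ (Y.piecewise a b') := by
    intro i hi b b' hne a
    by_contra hcon
    apply hne
    have hsq : ∀ a, (φ (flipVar (u i) a) * φ a) * (φ (flipVar (u i) a) * φ a) = 1 := by
      intro a
      rw [mul_mul_mul_comm, hφ, hφ, one_mul]
    have hneg : (φ (flipVar (u i) (Y.piecewise a b)) * φ (Y.piecewise a b)) *
        (φ (flipVar (u i) (Y.piecewise a b')) * φ (Y.piecewise a b')) = -1 := by
      rcases mul_self_eq_one_iff.1 (hsq (Y.piecewise a b)) with h | h <;>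
      rcases mul_self_eq_one_iff.1 (hsq (Y.piecewise a b')) with h' | h' <;>
      rw [h, h'] at hcon ⊢ <;> first | exact absurd rfl hcon | norm_num
    have hflip := Equiv.sum_comp (flipVar_involutive (u i)).toPerm
      fun a => φ (Y.piecewise a b) * φ (Y.piecewise a b')
    have hflip' : ∑ c, φ (Y.piecewise (flipVar (u i) c) b) * φ (Y.piecewise (flipVar (u i) c) b') =
        ∑ c, φ (Y.piecewise c b) * φ (Y.piecewise c b') := hflip
    have hc : ∀ c, φ (Y.piecewise (flipVar (u i) c) b) * φ (Y.piecewise (flipVar (u i) c) b') =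
        -(φ (Y.piecewise c b) * φ (Y.piecewise c b')) := by
      intro c
      rw [piecewise_flipVar (hu i hi), piecewise_flipVar (hu i hi)]
      have h := (hsplit i hi c a b b').trans hneg
      have h1 := hφ (Y.piecewise c b)
      have h2 := hφ (Y.piecewise c b')
      linear_combination (φ (Y.piecewise c b) * φ (Y.piecewise c b')) * h -
        φ (flipVar (u i) (Y.piecewise c b)) * φ (flipVar (u i) (Y.piecewise c b')) *
          (φ (Y.piecewise c b') * φ (Y.piecewise c b') * h1 + h2)
    simp only [hc, Finset.sum_neg_distrib] at hflip'
    linarith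
  have hcount : ∀ b, (∑ b', |∑ a, φ (Y.piecewise a b) * φ (Y.piecewise a b')|) * 2 ^ L.card ≤
      2 ^ Fintype.card V * 2 ^ Fintype.card V := by
    intro b
    set T : Finset (V → Bool) :=
      {b' | ∑ a, φ (Y.piecewise a b) * φ (Y.piecewise a b') ≠ 0} with hT
    -- Members of `T` have the same derivatives as `b`, but two assignments that agree outside `W`
    -- and differ at some `v i` have opposite ones. So a member of `T` is determined by its values
    -- outside `W`.
    have hTc : T.card * 2 ^ L.card ≤ 2 ^ Fintype.card V := by
      rw [← Finset.card_image_of_injOn hv, ← hW]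
      refine card_le_of_eq_outside T W fun b₁ h₁ b₂ h₂ hout => ?_
      simp only [hT, Finset.mem_filter, Finset.mem_univ, true_and] at h₁ h₂
      ext1 x
      by_contra hx
      have hxW : x ∈ W := by
        by_contra hxW
        exact hx (hout x hxW)
      rw [hW, Finset.mem_image] at hxW
      obtain ⟨i, hi, rfl⟩ := hxW
      have e₁ := hzero i hi b b₁ h₁ b
      have e₂ := hzero i hi b b₂ h₂ b
      have e₃ := hsens i hi b b₁ b₂ hout hx
      have hsq : (φ (flipVar (u i) (Y.piecewise b b₁)) * φ (Y.piecewise b b₁)) *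
          (φ (flipVar (u i) (Y.piecewise b b₁)) * φ (Y.piecewise b b₁)) = 1 := by
        rw [mul_mul_mul_comm, hφ, hφ, one_mul]
      have hz : φ (flipVar (u i) (Y.piecewise b b₁)) * φ (Y.piecewise b b₁) = 0 := by linarith
      rw [hz] at hsq
      norm_num at hsq
    have hsum : ∑ b', |∑ a, φ (Y.piecewise a b) * φ (Y.piecewise a b')| ≤
        T.card * 2 ^ Fintype.card V := by
      rw [← nsmul_eq_mul, ← Finset.sum_const]
      rw [← Finset.sum_subset (Finset.subset_univ T)]
      · exact Finset.sum_le_sum fun b' _ => hterm b b'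
      · intro b' _ hb'
        simp only [hT, Finset.mem_filter, Finset.mem_univ, true_and, not_not] at hb'
        rw [hb', abs_zero]
    have hTr : (T.card : ℝ) * 2 ^ L.card ≤ 2 ^ Fintype.card V := by exact_mod_cast hTc
    calc _ ≤ ((T.card : ℝ) * 2 ^ Fintype.card V) * 2 ^ L.card :=
          mul_le_mul_of_nonneg_right hsum (by positivity)
      _ = (T.card * 2 ^ L.card) * (2 : ℝ) ^ Fintype.card V := by ring
      _ ≤ _ := mul_le_mul_of_nonneg_right hTr (by positivity)
  have hpos : (0 : ℝ) < 2 ^ Fintype.card V := by positivity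
  refine le_of_mul_le_mul_left ?_ hpos
  calc _ = (2 ^ Fintype.card V * (∑ a with a ∈ S, φ a) ^ 2) * 2 ^ L.card := by ring
    _ ≤ (∑ b, ∑ b', |∑ a, φ (Y.piecewise a b) * φ (Y.piecewise a b')|) * 2 ^ L.card :=
        mul_le_mul_of_nonneg_right (sq_sum_rectangle_le Y S hS φ) (by positivity)
    _ = ∑ b, (∑ b', |∑ a, φ (Y.piecewise a b) * φ (Y.piecewise a b')|) * 2 ^ L.card := by
        rw [Finset.sum_mul]
    _ ≤ ∑ _b : V → Bool, (2 : ℝ) ^ Fintype.card V * 2 ^ Fintype.card V :=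
        Finset.sum_le_sum fun b _ => hcount b
    _ = _ := by
        simp
        ring

/-- The sign `(-1) ^ b`. -/
def boolSign (b : Bool) : ℝ := if b then -1 else 1

theorem boolSign_mul_self (b : Bool) : boolSign b * boolSign b = 1 := by
  cases b <;> norm_num [boolSign]

theorem boolSign_xor (a b : Bool) : boolSign (xor a b) = boolSign a * boolSign b := by
  cases a <;> cases b <;> norm_num [boolSign]

theorem boolSign_not (b : Bool) : boolSign (!b) = -boolSign b := by
  cases b <;> norm_num [boolSign]

/-- The sign of the quadratic form of a graph with set of edges `I` over the field with two
elements; the edge `e` has the ends `p e` and `q e`. -/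
def graphSign {V ε : Type*} (I : Finset ε) (p q : ε → V) (a : V → Bool) : ℝ :=
  ∏ e ∈ I, boolSign (a (p e) && a (q e))

theorem graphSign_mul_self {V ε : Type*} (I : Finset ε) (p q : ε → V) (a : V → Bool) :
    graphSign I p q a * graphSign I p q a = 1 := by
  rw [graphSign, ← Finset.prod_mul_distrib]
  exact Finset.prod_eq_one fun e _ => boolSign_mul_self _

/-- The derivative of the sign of a quadratic form is the product over the incident edges of the
signs of the other ends. -/
theorem graphSign_flipVar_mul {V ε : Type*} [DecidableEq V] (I : Finset ε) (p q : ε → V)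
    (hpq : ∀ e ∈ I, p e ≠ q e) (u : V) (a : V → Bool) :
    graphSign I p q (flipVar u a) * graphSign I p q a =
      ∏ e ∈ I, if p e = u then boolSign (a (q e))
        else if q e = u then boolSign (a (p e)) else 1 := by
  rw [graphSign, graphSign, ← Finset.prod_mul_distrib]
  refine Finset.prod_congr rfl fun e he => ?_
  have hne := hpq e he
  by_cases h1 : p e = u
  · subst h1
    rw [if_pos rfl]
    simp only [flipVar, Function.update_self, Function.update_of_ne hne.symm]
    cases a (p e) <;> cases a (q e) <;> norm_num [boolSign]
  rw [if_neg h1]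
  by_cases h2 : q e = u
  · subst h2
    rw [if_pos rfl]
    simp only [flipVar, Function.update_self, Function.update_of_ne hne]
    cases a (p e) <;> cases a (q e) <;> norm_num [boolSign]
  rw [if_neg h2]
  simp only [flipVar, Function.update_of_ne h1, Function.update_of_ne h2]
  exact boolSign_mul_self _

/-- The sign of the quadratic form of a graph has small sum over rectangles for partitions that are
crossed by a large induced matching. -/
theorem sq_sum_graphSign_mul_le {ε ι : Type*} (Y : Finset V) (S : Set (V → Bool))
    [DecidablePred (· ∈ S)] (hS : IsRectangle Y S) (I : Finset ε) (p q : ε → V)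
    (hpq : ∀ e ∈ I, p e ≠ q e) (L : Finset ι) (u v : ι → V) (m : ι → ε)
    (hu : ∀ i ∈ L, u i ∈ Y) (hvY : ∀ i ∈ L, v i ∉ Y) (hv : Set.InjOn v L) (hm : ∀ i ∈ L, m i ∈ I)
    (hends : ∀ i ∈ L, (p (m i) = u i ∧ q (m i) = v i) ∨ (p (m i) = v i ∧ q (m i) = u i))
    (hind : ∀ e ∈ I, ∀ i ∈ L, ∀ j ∈ L,
      (p e = u i ∧ q e = v j) ∨ (p e = v j ∧ q e = u i) → e = m i) :
    (∑ a with a ∈ S, graphSign I p q a) ^ 2 * 2 ^ L.card ≤ (2 ^ Fintype.card V) ^ 2 := by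
  classical
  refine sq_sum_rectangle_mul_le Y S hS _ (graphSign_mul_self I p q) L u v hu hv _ rfl ?_ ?_
  · intro i hi a a' b b'
    simp only [graphSign_flipVar_mul I p q hpq]
    rw [← Finset.prod_mul_distrib, ← Finset.prod_mul_distrib]
    -- A neighbour in `Y` contributes a square, and one outside `Y` does not see `a`.
    have key : ∀ x, boolSign (Y.piecewise a b x) * boolSign (Y.piecewise a b' x) =
        boolSign (Y.piecewise a' b x) * boolSign (Y.piecewise a' b' x) := by
      intro x
      by_cases hx : x ∈ Y <;> simp [hx, boolSign_mul_self]
    refine Finset.prod_congr rfl fun e he => ?_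
    split_ifs
    · exact key _
    · exact key _
    · rfl
  · intro i hi a b b' hout hne
    simp only [graphSign_flipVar_mul I p q hpq]
    rw [← Finset.mul_prod_erase I _ (hm i hi), ← Finset.mul_prod_erase I _ (hm i hi), ← neg_mul]
    have huv : u i ≠ v i := fun h => hvY i hi (h ▸ hu i hi)
    have hsign : boolSign (Y.piecewise a b (v i)) = -boolSign (Y.piecewise a b' (v i)) := by
      rw [Finset.piecewise_eq_of_notMem _ _ _ (hvY i hi),
        Finset.piecewise_eq_of_notMem _ _ _ (hvY i hi), ← boolSign_not]
      congr 1
      revert hne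
      cases b (v i) <;> cases b' (v i) <;> simp
    have heq : ∀ x, (∀ j ∈ L, x ≠ v j) → Y.piecewise a b x = Y.piecewise a b' x := by
      intro x hx
      by_cases hxY : x ∈ Y
      · simp [hxY]
      · simp only [Finset.piecewise_eq_of_notMem _ _ _ hxY]
        refine hout x fun hmem => ?_
        obtain ⟨j, hj, rfl⟩ := Finset.mem_image.1 hmem
        exact hx j hj rfl
    congr 1
    · rcases hends i hi with ⟨h1, h2⟩ | ⟨h1, h2⟩
      · rw [if_pos h1, if_pos h1, h2, hsign]
      · have h3 : p (m i) ≠ u i := fun h => huv (h.symm.trans h1)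
        rw [if_neg h3, if_neg h3, if_pos h2, if_pos h2, h1, hsign]
    -- Because the matching is induced, no other edge at `u i` ends in some `v j`, so only the
    -- factor of `m i` changes.
    · refine Finset.prod_congr rfl fun e he => ?_
      obtain ⟨hne', heI⟩ := Finset.mem_erase.1 he
      split_ifs with h1 h2
      · rw [heq]
        exact fun j hj h => hne' (hind e heI i hi j hj (.inl ⟨h1, h⟩))
      · rw [heq]
        exact fun j hj h => hne' (hind e heI i hi j hj (.inr ⟨h, h2⟩))
      · rfl

end Discrepancy

/-! ### From constant-state programs to layered FBDDs -/

/-- A program that reads one variable in each of `M` time steps, where the variable may depend on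
the current state, with a finite set of states. -/
structure LevelledProgram (V : Type*) where
  State : Type
  fintypeState : Fintype State
  start : State
  length : ℕ
  var : ℕ → State → V
  next : ℕ → State → Bool → State
  out : State → Bool

namespace LevelledProgram

variable {V : Type*} (P : LevelledProgram V)

instance : Fintype P.State := P.fintypeState

/-- The states that can be reached in `t` steps. -/
inductive Reaches : ℕ → P.State → Prop
  | zero : Reaches 0 P.start
  | succ {t : ℕ} {q : P.State} (b : Bool) : Reaches t q → Reaches (t + 1) (P.next t q b)

/-- The state after `t` steps under the assignment `a`. -/
def run (a : V → Bool) : ℕ → P.State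
  | 0 => P.start
  | t + 1 => P.next t (run a t) (a (P.var t (run a t)))

theorem reaches_run (a : V → Bool) (t : ℕ) : P.Reaches t (P.run a t) := by
  induction t with
  | zero => exact .zero
  | succ t ih => exact .succ _ ih

/-- The nodes of the diagram of a program: a time step and a state that is reached then. -/
abbrev Node : Type := {p : Fin P.length × P.State // P.Reaches p.1 p.2}

/-- The node of the diagram at time `t` in state `q`, which is a sink at the end. -/
def node (t : ℕ) (q : P.State) (hq : P.Reaches t q) : P.Node ⊕ Bool :=
  if ht : t < P.length then .inl ⟨(⟨t, ht⟩, q), hq⟩ else .inr (P.out q)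

/-- The successor of a node. -/
def succ (d : P.Node) (b : Bool) : P.Node ⊕ Bool :=
  P.node (d.1.1 + 1) (P.next d.1.1 d.1.2 b) (d.2.succ b)

/-- The time step of a node; sinks come last. -/
def layer : P.Node ⊕ Bool → ℕ
  | .inl d => d.1.1
  | .inr _ => P.length

variable {P}

theorem layer_node {t : ℕ} (ht : t ≤ P.length) {q : P.State} (hq : P.Reaches t q) :
    P.layer (P.node t q hq) = t := by
  unfold node
  split_ifs with h
  · rfl
  · simp only [layer]
    omega

theorem layer_succ (d : P.Node) (b : Bool) : P.layer (P.succ d b) = P.layer (.inl d) + 1 :=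
  layer_node d.1.1.2 _

variable (P)

/-- The binary decision diagram of a program. -/
noncomputable def toBDD (hM : 0 < P.length)
    (hout : ∀ b, ∃ q, P.Reaches P.length q ∧ P.out q = b) : BDD V where
  Decision := P.Node
  fintypeDecision := Fintype.ofFinite _
  var d := P.var d.1.1 d.1.2
  succ := P.succ
  source := .inl ⟨(⟨0, hM⟩, P.start), .zero⟩
  acyclic := by
    refine Subrelation.wf ?_ (measure fun u => P.length - P.layer u).wf
    rintro v u ⟨d, b, rfl, rfl⟩
    have h1 := layer_succ d b
    have h2 : P.layer (.inl d) < P.length := d.1.1.2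
    change P.length - P.layer (P.succ d b) < P.length - P.layer (.inl d)
    omega
  -- Nodes are restricted to reachable states, so the last step of a derivation of reachability
  -- supplies an incoming edge. For the sinks this is where `hout` is needed.
  source_iff v := by
    constructor
    · rintro rfl ⟨d, b, h⟩
      have h1 := layer_succ d b
      rw [← h] at h1
      simp [layer] at h1
    · intro h
      rcases v with ⟨⟨⟨t, ht⟩, q⟩, hq⟩ | b
      · cases hq with
        | zero => rfl
        | @succ t q b hq =>
          refine absurd ⟨⟨(⟨t, (Nat.lt_succ_self t).trans ht⟩, q), hq⟩, b, ?_⟩ h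
          simp [succ, node, ht]
      · obtain ⟨q, hq, rfl⟩ := hout b
        refine absurd ?_ h
        obtain ⟨M, hMe⟩ : ∃ M, M = P.length := ⟨_, rfl⟩
        rw [← hMe] at hq
        cases hq with
        | zero => omega
        | @succ t q b hq =>
          refine ⟨⟨(⟨t, by omega⟩, q), hq⟩, b, ?_⟩
          simp [succ, node, ← hMe]

variable (hM : 0 < P.length) (hout : ∀ b, ∃ q, P.Reaches P.length q ∧ P.out q = b)

theorem evalFrom_toBDD (a : V → Bool) (t : ℕ) (ht : t ≤ P.length) :
    (P.toBDD hM hout).evalFrom a (P.toBDD hM hout).source =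
      (P.toBDD hM hout).evalFrom a (P.node t (P.run a t) (P.reaches_run a t)) := by
  induction t with
  | zero => simp [node, toBDD, hM, run]
  | succ t ih =>
    rw [ih (by omega)]
    have h : P.node t (P.run a t) (P.reaches_run a t) =
        .inl ⟨(⟨t, by omega⟩, P.run a t), P.reaches_run a t⟩ := by
      rw [node, dif_pos (by omega)]
    rw [h]
    exact (P.toBDD hM hout).evalFrom_decision a _

theorem toBDD_computes : (P.toBDD hM hout).Computes fun a => P.out (P.run a P.length) := by
  intro a
  rw [P.evalFrom_toBDD hM hout a P.length le_rfl]
  have h : P.node P.length (P.run a P.length) (P.reaches_run a P.length) =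
      .inr (P.out (P.run a P.length)) := by
    rw [node, dif_neg (lt_irrefl _)]
  rw [h]
  exact (P.toBDD hM hout).evalFrom_sink a _

theorem size_toBDD_le :
    (P.toBDD hM hout).size ≤ P.length * Fintype.card P.State + 2 := by
  have h : @Fintype.card _ (P.toBDD hM hout).fintypeDecision ≤
      Fintype.card (Fin P.length × P.State) :=
    @Fintype.card_le_of_injective _ _ (P.toBDD hM hout).fintypeDecision _
      (fun d : P.Node => d.1) Subtype.val_injective
  rw [Fintype.card_prod, Fintype.card_fin] at h
  exact Nat.add_le_add_right h 2

theorem isLayeredOfWidthLE_toBDD :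
    (P.toBDD hM hout).IsLayeredOfWidthLE (Fintype.card P.State + 2) := by
  refine ⟨P.layer, ?_, fun i => ?_⟩
  · rintro u v ⟨d, b, rfl, rfl⟩
    exact layer_succ d b
  -- Within a layer the time is fixed, so a node is determined by its state or by its sink label.
  · let g : P.Node ⊕ Bool → P.State ⊕ Bool := Sum.map (fun d => d.1.2) id
    have hinj : Set.InjOn g {u | P.layer u = i} := by
      rintro (⟨⟨t, q⟩, hq⟩ | b) hu (⟨⟨t', q'⟩, hq'⟩ | b') hu' h
      · have ht : t = t' := Fin.ext (Eq.trans hu (Eq.symm hu'))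
        have hqq : q = q' := by simpa [g] using h
        subst ht hqq
        rfl
      · simp [g] at h
      · simp [g] at h
      · simpa [g] using h
    refine (Set.ncard_le_ncard_of_injOn g (t := Set.univ) (fun _ _ => Set.mem_univ _) hinj).trans ?_
    rw [Set.ncard_univ, Nat.card_eq_fintype_card]
    simp

/-- The diagram is free if a transitive relation that contains all steps of the program relates
only pairs of a time and a state with different variables. -/
theorem isFree_toBDD (R : ℕ × P.State → ℕ × P.State → Prop)
    (htrans : ∀ u v w, R u v → R v w → R u w)
    (hstep : ∀ t q b, R (t, q) (t + 1, P.next t q b))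
    (hvar : ∀ t q t' q', t < P.length → t' < P.length → R (t, q) (t', q') →
      P.var t q ≠ P.var t' q') :
    (P.toBDD hM hout).IsFree := by
  rintro p ⟨hc, -, -⟩
  let R' : P.Node ⊕ Bool → P.Node ⊕ Bool → Prop := fun u v =>
    match u, v with
    | .inl d, .inl e => R (d.1.1, d.1.2) (e.1.1, e.1.2)
    | .inl _, .inr _ => True
    | .inr _, _ => False
  have : IsTrans _ R' := ⟨by
    rintro (d | b) (e | b') (f | b'') h1 h2
    · exact htrans _ _ _ h1 h2
    · trivial
    · exact h2.elim
    · trivial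
    · exact h1.elim
    · exact h1.elim
    · exact h1.elim
    · exact h1.elim⟩
  have hc' : p.IsChain R' := by
    refine hc.imp ?_
    rintro u v ⟨d, b, rfl, rfl⟩
    change R' (.inl d) (P.succ d b)
    unfold succ node
    split_ifs
    · exact hstep _ _ _
    · trivial
  have hp := hc'.pairwise
  refine List.Pairwise.filterMap _ ?_ hp
  rintro (d | b) (e | b') h x hx y hy
  · simp only [BDD.nodeVar?, Sum.getLeft?_inl, Option.map_some, Option.some.injEq] at hx hy
    subst hx hy
    exact hvar _ _ _ _ d.1.1.2 e.1.1.2 h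
  · simp [BDD.nodeVar?] at hy
  · exact h.elim
  · exact h.elim

end LevelledProgram

/-! ### The grid graph and its cuts by balanced partitions -/

section Grid

/-- The variable of the cell of a `K × K` grid that comes at position `t` when the grid is read row
by row (`β = false`) or column by column (`β = true`). The last variable is not in the grid. -/
def gridVar (K : ℕ) (β : Bool) (t : ℕ) : Fin (K * K + 1) :=
  Fin.ofNat (K * K + 1) (if β then (t % K) * K + t / K else t)

/-- The row (`β = false`) or column (`β = true`) of a cell of the grid. -/
def gridLine (K : ℕ) (β : Bool) (y : Fin (K * K + 1)) : ℕ := if β then y % K else y / K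

/-- The edges of the grid in the directions `T`: the edge `(β, t)` joins the cells at the positions
`t` and `t + 1`. -/
def gridEdges (K : ℕ) (T : Finset Bool) : Finset (Bool × ℕ) :=
  T ×ˢ {t ∈ Finset.range (K * K) | (t + 1) % K ≠ 0}

/-- The sign of the quadratic form of the grid graph with edges in the directions `T`. -/
def gridSign (K : ℕ) (T : Finset Bool) (a : Fin (K * K + 1) → Bool) : ℝ :=
  graphSign (gridEdges K T) (fun e => gridVar K e.1 e.2) (fun e => gridVar K e.1 (e.2 + 1)) a

variable {K : ℕ} {β : Bool} {t : ℕ}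

theorem gridVar_val (ht : t < K * K) :
    (gridVar K β t : ℕ) = if β then (t % K) * K + t / K else t := by
  have hK : 0 < K := Nat.pos_of_ne_zero (by rintro rfl; simp at ht)
  refine Nat.mod_eq_of_lt ?_
  split_ifs
  · have h1 := Nat.mod_lt t hK
    have h2 := Nat.div_lt_of_lt_mul ht
    nlinarith
  · omega

theorem gridVar_lt (ht : t < K * K) : (gridVar K β t : ℕ) < K * K := by
  have hK : 0 < K := Nat.pos_of_ne_zero (by rintro rfl; simp at ht)
  rw [gridVar_val ht]
  split_ifs
  · have h1 := Nat.mod_lt t hK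
    have h2 := Nat.div_lt_of_lt_mul ht
    nlinarith
  · exact ht

theorem gridVar_ne_last (ht : t < K * K) : gridVar K β t ≠ Fin.last _ := by
  intro h
  have h1 := gridVar_lt (β := β) ht
  rw [h] at h1
  simp at h1

theorem gridLine_gridVar (ht : t < K * K) : gridLine K β (gridVar K β t) = t / K := by
  have hK : 0 < K := Nat.pos_of_ne_zero (by rintro rfl; simp at ht)
  have h2 := Nat.div_lt_of_lt_mul ht
  rw [gridLine, gridVar_val ht]
  cases β
  · simp
  · simp [Nat.add_mod, Nat.mod_eq_of_lt h2]

theorem gridLine_gridVar_not (ht : t < K * K) : gridLine K β (gridVar K (!β) t) = t % K := by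
  have hK : 0 < K := Nat.pos_of_ne_zero (by rintro rfl; simp at ht)
  have h2 := Nat.div_lt_of_lt_mul ht
  rw [gridLine, gridVar_val ht]
  cases β
  · simp [Nat.add_div_of_dvd_right (Dvd.intro_left (t % K) rfl), Nat.mul_div_cancel _ hK,
      Nat.div_eq_of_lt h2]
  · simp

theorem gridVar_inj {t' : ℕ} (ht : t < K * K) (ht' : t' < K * K)
    (h : gridVar K β t = gridVar K β t') : t = t' := by
  have h1 := congrArg (gridLine K β) h
  rw [gridLine_gridVar ht, gridLine_gridVar ht'] at h1
  have h2 := congrArg (gridLine K (!β)) h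
  have h3 := gridLine_gridVar_not (β := !β) ht
  have h4 := gridLine_gridVar_not (β := !β) ht'
  rw [Bool.not_not] at h3 h4
  rw [h3, h4] at h2
  rw [← Nat.div_add_mod t K, ← Nat.div_add_mod t' K, h1, h2]

theorem succ_div_mod_of_mod_ne_zero (ht : t < K * K) (hw : (t + 1) % K ≠ 0) :
    t + 1 < K * K ∧ (t + 1) / K = t / K ∧ (t + 1) % K = t % K + 1 := by
  have hK : 0 < K := Nat.pos_of_ne_zero (by rintro rfl; simp at ht)
  have hd : ¬ K ∣ t + 1 := fun h => hw (Nat.mod_eq_zero_of_dvd h)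
  have h1 : (t + 1) / K = t / K := Nat.succ_div_of_not_dvd hd
  refine ⟨lt_of_le_of_ne ht fun h => hd (h ▸ Dvd.intro _ rfl), h1, ?_⟩
  have h2 := Nat.div_add_mod t K
  have h3 := Nat.div_add_mod (t + 1) K
  rw [h1] at h3
  omega

theorem mul_add_div_mod {l j : ℕ} (hj : j < K) : (l * K + j) / K = l ∧ (l * K + j) % K = j := by
  constructor
  · rw [mul_comm, Nat.mul_add_div (by omega), Nat.div_eq_of_lt hj, add_zero]
  · rw [mul_comm, Nat.mul_add_mod, Nat.mod_eq_of_lt hj]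

theorem mul_add_lt_mul_self {l j : ℕ} (hl : l < K) (hj : j < K) : l * K + j < K * K := by
  nlinarith

/-- The line `l` contains both variables in `Y` and variables not in `Y`. -/
def IsMixedLine (K : ℕ) (β : Bool) (Y : Finset (Fin (K * K + 1))) (l : ℕ) : Prop :=
  ∃ j < K, ∃ j' < K, gridVar K β (l * K + j) ∈ Y ∧ gridVar K β (l * K + j') ∉ Y

/-- If no two consecutive cells were separated by `Y`, membership in `Y` would be constant along the
line. -/
theorem IsMixedLine.exists_edge {Y : Finset (Fin (K * K + 1))} {l : ℕ} (hl : l < K)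
    (h : IsMixedLine K β Y l) :
    ∃ t < K * K, (t + 1) % K ≠ 0 ∧ t / K = l ∧
      ¬ (gridVar K β t ∈ Y ↔ gridVar K β (t + 1) ∈ Y) := by
  obtain ⟨j, hj, j', hj', h1, h2⟩ := h
  by_contra! hcon
  have hconst : ∀ j < K, gridVar K β (l * K + j) ∈ Y ↔ gridVar K β (l * K + 0) ∈ Y := by
    intro j
    induction j with
    | zero => simp
    | succ j ih =>
      intro hj
      rw [← ih (by omega)]
      refine (hcon (l * K + j) (mul_add_lt_mul_self hl (by omega)) ?_ ?_).symm
      · rw [add_assoc, (mul_add_div_mod hj).2]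
        omega
      · exact (mul_add_div_mod (by omega)).1
  exact h2 ((hconst j' hj').2 ((hconst j hj).1 h1))

theorem mem_gridEdges {T : Finset Bool} {e : Bool × ℕ} :
    e ∈ gridEdges K T ↔ e.1 ∈ T ∧ e.2 < K * K ∧ (e.2 + 1) % K ≠ 0 := by
  simp [gridEdges]

/-- One crossing edge from each line of `L` forms an induced matching: an edge in direction `β`
stays in its line, and an edge in the other direction joins neighbouring lines, which `hadj`
excludes from `L`. -/
theorem sq_sum_gridSign_mul_le (T : Finset Bool) (hβ : β ∈ T) (Y : Finset (Fin (K * K + 1)))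
    (S : Set (Fin (K * K + 1) → Bool)) [DecidablePred (· ∈ S)] (hS : IsRectangle Y S)
    (L : Finset ℕ) (hL : ∀ l ∈ L, l < K ∧ IsMixedLine K β Y l)
    (hadj : ∀ l ∈ L, l + 1 ∉ L) :
    (∑ a with a ∈ S, gridSign K T a) ^ 2 * 2 ^ L.card ≤ (2 ^ (K * K + 1)) ^ 2 := by
  have hex : ∀ l, ∃ t, l ∈ L → t < K * K ∧ (t + 1) % K ≠ 0 ∧ t / K = l ∧
      ¬ (gridVar K β t ∈ Y ↔ gridVar K β (t + 1) ∈ Y) := by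
    intro l
    by_cases hl : l ∈ L
    · obtain ⟨t, ht⟩ := (hL l hl).2.exists_edge (hL l hl).1
      exact ⟨t, fun _ => ⟨ht.1, ht.2⟩⟩
    · exact ⟨0, fun h => absurd h hl⟩
  choose τ hτ using hex
  let u : ℕ → Fin (K * K + 1) := fun l =>
    if gridVar K β (τ l) ∈ Y then gridVar K β (τ l) else gridVar K β (τ l + 1)
  let v : ℕ → Fin (K * K + 1) := fun l =>
    if gridVar K β (τ l) ∈ Y then gridVar K β (τ l + 1) else gridVar K β (τ l)
  have huv : ∀ l ∈ L, (u l = gridVar K β (τ l) ∧ v l = gridVar K β (τ l + 1) ∧ u l ∈ Y ∧ v l ∉ Y) ∨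
      (u l = gridVar K β (τ l + 1) ∧ v l = gridVar K β (τ l) ∧ u l ∈ Y ∧ v l ∉ Y) := by
    intro l hl
    obtain ⟨-, -, -, h⟩ := hτ l hl
    by_cases hY : gridVar K β (τ l) ∈ Y
    · left
      simp only [u, v, if_pos hY, true_and]
      exact ⟨hY, fun h' => h ⟨fun _ => h', fun _ => hY⟩⟩
    · right
      simp only [u, v, if_neg hY, true_and]
      refine ⟨?_, hY⟩
      by_contra h'
      exact h ⟨fun h => absurd h hY, fun h => absurd h h'⟩
  have hline : ∀ l ∈ L, gridLine K β (u l) = l ∧ gridLine K β (v l) = l := by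
    intro l hl
    obtain ⟨h1, h2, h3, -⟩ := hτ l hl
    obtain ⟨h4, h5, -⟩ := succ_div_mod_of_mod_ne_zero h1 h2
    rcases huv l hl with ⟨hu, hv, -⟩ | ⟨hu, hv, -⟩ <;>
      rw [hu, hv, gridLine_gridVar h1, gridLine_gridVar h4, h5] <;> exact ⟨h3, h3⟩
  have hmain := sq_sum_graphSign_mul_le Y S hS (gridEdges K T) (fun e => gridVar K e.1 e.2)
    (fun e => gridVar K e.1 (e.2 + 1)) ?_ L u v (fun l => (β, τ l)) ?_ ?_ ?_ ?_ ?_ ?_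
  · simpa [gridSign] using hmain
  · rintro ⟨γ, t⟩ he h
    obtain ⟨-, h1, h2⟩ := mem_gridEdges.1 he
    have := gridVar_inj h1 (succ_div_mod_of_mod_ne_zero h1 h2).1 h
    omega
  · intro l hl
    rcases huv l hl with h | h <;> exact h.2.2.1
  · intro l hl
    rcases huv l hl with h | h <;> exact h.2.2.2
  · intro l hl l' hl' h
    rw [← (hline l hl).2, ← (hline l' hl').2, h]
  · intro l hl
    exact mem_gridEdges.2 ⟨hβ, (hτ l hl).1, (hτ l hl).2.1⟩
  · intro l hl
    rcases huv l hl with ⟨hu, hv, -⟩ | ⟨hu, hv, -⟩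
    · exact .inl ⟨hu.symm, hv.symm⟩
    · exact .inr ⟨hv.symm, hu.symm⟩
  · rintro ⟨γ, s⟩ he i hi j hj hends
    obtain ⟨-, h1, h2⟩ := mem_gridEdges.1 he
    dsimp only at h1 h2 hends
    obtain ⟨h3, h4, h5⟩ := succ_div_mod_of_mod_ne_zero h1 h2
    by_cases hγ : γ = β
    · subst hγ
      have hij : i = j := by
        rw [← (hline i hi).1, ← (hline j hj).2]
        rcases hends with ⟨e1, e2⟩ | ⟨e1, e2⟩ <;>
          rw [← e1, ← e2, gridLine_gridVar h1, gridLine_gridVar h3, h4]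
      subst hij
      obtain ⟨t1, t2, -⟩ := hτ i hi
      have t3 := (succ_div_mod_of_mod_ne_zero t1 t2).1
      -- The reversed orientation would require `s = τ i + 1` and `s + 1 = τ i`.
      have hs : s = τ i := by
        rcases huv i hi with ⟨hu, hv, -⟩ | ⟨hu, hv, -⟩ <;> rw [hu, hv] at hends <;>
          rcases hends with ⟨e1, e2⟩ | ⟨e1, e2⟩
        · exact gridVar_inj h1 t1 e1
        · have := gridVar_inj h1 t3 e1
          have := gridVar_inj h3 t1 e2
          omega
        · have := gridVar_inj h1 t3 e1
          have := gridVar_inj h3 t1 e2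
          omega
        · exact gridVar_inj h1 t1 e1
      rw [hs]
    · have hγ' : γ = !β := by
        revert hγ
        cases γ <;> cases β <;> simp
      subst hγ'
      exfalso
      have e3 := gridLine_gridVar_not (β := β) h1
      have e4 := gridLine_gridVar_not (β := β) h3
      rcases hends with ⟨e1, e2⟩ | ⟨e1, e2⟩
      · rw [e1, (hline i hi).1] at e3
        rw [e2, (hline j hj).2] at e4
        have : j = i + 1 := by omega
        exact hadj i hi (this ▸ hj)
      · rw [e1, (hline j hj).2] at e3
        rw [e2, (hline i hi).1] at e4
        have : i = j + 1 := by omega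
        exact hadj j hj (this ▸ hi)

theorem exists_nonadjacent_subset (M : Finset ℕ) :
    ∃ L ⊆ M, (∀ l ∈ L, l + 1 ∉ L) ∧ M.card ≤ 2 * L.card := by
  have h := Finset.card_filter_add_card_filter_not (s := M) (fun l => l % 2 = 0)
  rcases le_total ({l ∈ M | l % 2 = 0}).card ({l ∈ M | ¬ l % 2 = 0}).card with h' | h'
  · refine ⟨_, Finset.filter_subset (fun l => ¬ l % 2 = 0) M, fun l hl hl' => ?_, by omega⟩
    have h1 := (Finset.mem_filter.1 hl).2
    have h2 := (Finset.mem_filter.1 hl').2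
    omega
  · refine ⟨_, Finset.filter_subset (fun l => l % 2 = 0) M, fun l hl hl' => ?_, by omega⟩
    have h1 := (Finset.mem_filter.1 hl).2
    have h2 := (Finset.mem_filter.1 hl').2
    omega

/-- The discrepancy bound for partitions with at least `n / 3` mixed lines. -/
theorem abs_sum_gridSign_le (T : Finset Bool) (hβ : β ∈ T) (Y : Finset (Fin (K * K + 1)))
    (S : Set (Fin (K * K + 1) → Bool)) [DecidablePred (· ∈ S)] (hS : IsRectangle Y S)
    (M : Finset ℕ) (hM : ∀ l ∈ M, l < K ∧ IsMixedLine K β Y l) {n : ℕ} (hn : n ≤ 3 * M.card) :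
    |∑ a with a ∈ S, gridSign K T a| ≤ 2 ^ (K * K + 1) * (2 : ℝ) ^ (-(n / 12 : ℝ)) := by
  obtain ⟨L, hLM, hadj, hcard⟩ := exists_nonadjacent_subset M
  have h := sq_sum_gridSign_mul_le T hβ Y S hS L (fun l hl => hM l (hLM hl)) hadj
  refine abs_le_of_sq_le_sq ?_ (by positivity)
  -- A third of `n` lines, halved by passing to nonadjacent ones, gives `n / 6` matching edges; the
  -- square root in the final bound turns this into `n / 12`.
  have hk : (2 : ℝ) ^ (n / 6 : ℝ) ≤ 2 ^ L.card := by
    rw [← Real.rpow_natCast]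
    refine Real.rpow_le_rpow_of_exponent_le one_le_two ?_
    have : n ≤ 6 * L.card := by omega
    have : (n : ℝ) ≤ 6 * L.card := by exact_mod_cast this
    linarith
  have hε : ((2 : ℝ) ^ (-(n / 12 : ℝ))) ^ 2 * (2 : ℝ) ^ (n / 6 : ℝ) = 1 := by
    rw [← Real.rpow_natCast, ← Real.rpow_mul zero_le_two, ← Real.rpow_add zero_lt_two]
    have : (-(n / 12 : ℝ)) * ((2 : ℕ) : ℝ) + n / 6 = 0 := by
      push_cast
      ring
    rw [this, Real.rpow_zero]
  have hpos : (0 : ℝ) < (2 : ℝ) ^ (n / 6 : ℝ) := by positivity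
  refine le_of_mul_le_mul_right ?_ hpos
  calc _ ≤ (∑ a with a ∈ S, gridSign K T a) ^ 2 * 2 ^ L.card :=
        mul_le_mul_of_nonneg_left hk (sq_nonneg _)
    _ ≤ _ := h
    _ = _ := by rw [mul_pow, mul_assoc, hε, mul_one]

theorem gridVar_true_eq {l j : ℕ} (hl : l < K) (hj : j < K) :
    gridVar K true (l * K + j) = gridVar K false (j * K + l) := by
  apply Fin.ext
  rw [gridVar_val (mul_add_lt_mul_self hl hj), gridVar_val (mul_add_lt_mul_self hj hl),
    if_pos rfl, if_neg Bool.false_ne_true, (mul_add_div_mod hj).1, (mul_add_div_mod hj).2]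

theorem gridVar_false_div_mod {y : Fin (K * K + 1)} (hy : y ≠ Fin.last _) :
    (y : ℕ) / K < K ∧ (y : ℕ) % K < K ∧ gridVar K false ((y : ℕ) / K * K + (y : ℕ) % K) = y := by
  have hlt : (y : ℕ) < K * K := by
    have h1 := y.2
    have h2 : (y : ℕ) ≠ K * K := fun h => hy (Fin.ext h)
    omega
  have hK : 0 < K := Nat.pos_of_ne_zero (by rintro rfl; simp at hlt)
  refine ⟨Nat.div_lt_of_lt_mul hlt, Nat.mod_lt _ hK, ?_⟩
  apply Fin.ext
  rw [Nat.div_add_mod', gridVar_val hlt, if_neg Bool.false_ne_true]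

theorem card_le_of_rows (Z : Finset (Fin (K * K + 1))) (M : Finset ℕ)
    (hZ : ∀ y ∈ Z, y ≠ Fin.last _ → (y : ℕ) / K ∈ M) : Z.card ≤ M.card * K + 1 := by
  have h1 : (Z.erase (Fin.last _)).card ≤ (M ×ˢ Finset.range K).card := by
    refine Finset.card_le_card_of_injOn (fun y => ((y : ℕ) / K, (y : ℕ) % K)) ?_ ?_
    · intro y hy
      obtain ⟨hy1, hy2⟩ := Finset.mem_erase.1 hy
      exact Finset.mem_product.2
        ⟨hZ y hy2 hy1, Finset.mem_range.2 (gridVar_false_div_mod hy1).2.1⟩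
    · intro y hy z hz h
      obtain ⟨h1, h2⟩ := Prod.mk.inj h
      rw [← (gridVar_false_div_mod (Finset.mem_erase.1 hy).1).2.2,
        ← (gridVar_false_div_mod (Finset.mem_erase.1 hz).1).2.2, h1, h2]
  rw [Finset.card_product, Finset.card_range] at h1
  have h2 := Finset.pred_card_le_card_erase (s := Z) (a := Fin.last _)
  omega

/-- A row inside `Y` together with a row outside `Y` makes every column mixed. If one kind is
missing, all rows meeting `Y`, or all rows meeting its complement, are mixed; that set has a third
of the variables, and each row covers only `K` of them. The summand `1` absorbs the variable off the
grid and is the reason for `K = n + 1` later. -/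
theorem exists_isMixedLine_of_isBalanced (hK : 2 ≤ K) {Y : Finset (Fin (K * K + 1))}
    (hY : IsBalanced Y) :
    ∃ β, ∃ M : Finset ℕ, (∀ l ∈ M, l < K ∧ IsMixedLine K β Y l) ∧ K ≤ 3 * M.card + 1 := by
  classical
  obtain ⟨hY1, hY2⟩ := hY
  rw [Fintype.card_fin] at hY1 hY2
  set M : Finset ℕ := {l ∈ Finset.range K | IsMixedLine K false Y l} with hM
  have hMm : ∀ l ∈ M, l < K ∧ IsMixedLine K false Y l := by
    intro l hl
    simpa [hM] using hl
  have hcount : ∀ Z : Finset (Fin (K * K + 1)), K * K + 1 ≤ 3 * Z.card →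
      (∀ y ∈ Z, y ≠ Fin.last _ → (y : ℕ) / K ∈ M) → K ≤ 3 * M.card + 1 := by
    intro Z hZ h
    have := card_le_of_rows Z M h
    by_contra! hlt
    nlinarith
  by_cases h0 : ∃ l < K, ∀ j < K, gridVar K false (l * K + j) ∈ Y
  · by_cases h1 : ∃ l < K, ∀ j < K, gridVar K false (l * K + j) ∉ Y
    · obtain ⟨l₀, hl₀, h0⟩ := h0
      obtain ⟨l₁, hl₁, h1⟩ := h1
      refine ⟨true, Finset.range K, fun l hl => ?_, by simp; omega⟩
      have hl := Finset.mem_range.1 hl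
      refine ⟨hl, l₀, hl₀, l₁, hl₁, ?_, ?_⟩
      · rw [gridVar_true_eq hl hl₀]
        exact h0 l hl
      · rw [gridVar_true_eq hl hl₁]
        exact h1 l hl
    · refine ⟨false, M, hMm, hcount Yᶜ ?_ fun y hy hne => ?_⟩
      · rw [Finset.card_compl, Fintype.card_fin]
        omega
      · obtain ⟨h2, h3, h4⟩ := gridVar_false_div_mod hne
        push Not at h1
        obtain ⟨j, hj, hjY⟩ := h1 _ h2
        refine Finset.mem_filter.2 ⟨Finset.mem_range.2 h2, j, hj, _, h3, hjY, ?_⟩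
        rw [h4]
        exact Finset.mem_compl.1 hy
  · refine ⟨false, M, hMm, hcount Y hY1 fun y hy hne => ?_⟩
    obtain ⟨h2, h3, h4⟩ := gridVar_false_div_mod hne
    push Not at h0
    obtain ⟨j, hj, hjY⟩ := h0 _ h2
    refine Finset.mem_filter.2 ⟨Finset.mem_range.2 h2, _, h3, j, hj, ?_, hjY⟩
    rw [h4]
    exact hy

/-- The whole cube is a rectangle for every partition, balanced or not. Separating the first cell of
each line from the second makes all lines mixed. -/
theorem abs_sum_gridSign_univ_le (hK : 2 ≤ K) (T : Finset Bool) (hβ : β ∈ T) {n : ℕ} (hn : n ≤ K) :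
    |∑ a, gridSign K T a| ≤ 2 ^ (K * K + 1) * (2 : ℝ) ^ (-(n / 12 : ℝ)) := by
  classical
  have h := abs_sum_gridSign_le (K := K) (n := n) T hβ {y | gridLine K (!β) y = 0} Set.univ
    (fun _ _ _ _ => Set.mem_univ _) (Finset.range K) (fun l hl => ?_) (by simp; omega)
  · simpa using h
  · have hl := Finset.mem_range.1 hl
    have hpos : ∀ j < K, gridLine K (!β) (gridVar K β (l * K + j)) = j := by
      intro j hj
      have h := gridLine_gridVar_not (β := !β) (mul_add_lt_mul_self hl hj)
      rw [Bool.not_not] at h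
      rw [h, (mul_add_div_mod hj).2]
    refine ⟨hl, 0, by omega, 1, by omega, ?_, ?_⟩
    · simp only [Finset.mem_filter, Finset.mem_univ, true_and]
      exact hpos 0 (by omega)
    · simp only [Finset.mem_filter, Finset.mem_univ, true_and]
      rw [hpos 1 (by omega)]
      exact one_ne_zero

end Grid

/-! ### The selector function: small FBDD and large deterministic DNNFs -/

section Grid

variable {K : ℕ}

/-- The program that reads the last variable and then computes the quadratic form of the row paths
or of the column paths of the grid. Its state consists of the direction, the current value of the
form, and the last value that was read (zero after the end of a line). -/
def gridProgram (K : ℕ) : LevelledProgram (Fin (K * K + 1)) where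
  State := Bool × Bool × Bool
  fintypeState := inferInstance
  start := (false, false, false)
  length := K * K + 1
  var t q := match t with
    | 0 => Fin.last _
    | t + 1 => gridVar K q.1 t
  next t q b := match t with
    | 0 => (b, false, false)
    | t + 1 => (q.1, xor q.2.1 (q.2.2 && b), decide ((t + 1) % K ≠ 0) && b)
  out q := q.2.1

/-- The function that is computed by `gridProgram`. -/
def gridFun (K : ℕ) (a : Fin (K * K + 1) → Bool) : Bool :=
  (gridProgram K).out ((gridProgram K).run a (gridProgram K).length)

/-- After `t + 2` steps the selector and the cells at positions `0` to `t` have been read, so the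
edges starting at positions below `t` are accounted for. Clearing the remembered bit at a line end
suppresses the non-edge to the next line. -/
theorem run_gridProgram (a : Fin (K * K + 1) → Bool) (t : ℕ) :
    ∃ s, (gridProgram K).run a (t + 2) = (a (Fin.last _), s,
        decide ((t + 1) % K ≠ 0) && a (gridVar K (a (Fin.last _)) t)) ∧
      boolSign s = ∏ i ∈ Finset.range t, boolSign (decide ((i + 1) % K ≠ 0) &&
        (a (gridVar K (a (Fin.last _)) i) && a (gridVar K (a (Fin.last _)) (i + 1)))) := by
  induction t with
  | zero => exact ⟨false, rfl, by simp [boolSign]⟩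
  | succ t ih =>
    obtain ⟨s, h1, h2⟩ := ih
    rw [LevelledProgram.run, h1]
    refine ⟨_, rfl, ?_⟩
    rw [boolSign_xor, h2, Finset.prod_range_succ]
    simp only [gridProgram, Bool.and_assoc]

theorem boolSign_gridFun (hK : 0 < K) (a : Fin (K * K + 1) → Bool) :
    boolSign (gridFun K a) = gridSign K {a (Fin.last _)} a := by
  obtain ⟨t, ht⟩ : ∃ t, K * K = t + 1 := ⟨K * K - 1, by have := Nat.mul_pos hK hK; omega⟩
  obtain ⟨s, h1, h2⟩ := run_gridProgram a t
  have h3 : gridFun K a = s := by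
    have : (gridProgram K).length = t + 2 := congrArg (· + 1) ht
    rw [gridFun, this, h1]
    rfl
  have h4 : (t + 1) % K = 0 := ht ▸ Nat.mul_mod_right K K
  have hr : Finset.range (K * K) = Finset.range (t + 1) := by rw [ht]
  rw [h3, h2, gridSign, graphSign, gridEdges, Finset.prod_product, Finset.prod_singleton,
    Finset.prod_filter, hr, Finset.prod_range_succ, if_neg (by simp [h4]), mul_one]
  refine Finset.prod_congr rfl fun i _ => ?_
  by_cases hi : (i + 1) % K = 0 <;> simp [hi, boolSign]

theorem gridSign_update (T : Finset Bool) (a : Fin (K * K + 1) → Bool) (b : Bool) :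
    gridSign K T (Function.update a (Fin.last _) b) = gridSign K T a := by
  refine Finset.prod_congr rfl fun e he => ?_
  obtain ⟨-, h1, h2⟩ := mem_gridEdges.1 he
  rw [Function.update_of_ne (gridVar_ne_last h1),
    Function.update_of_ne (gridVar_ne_last (succ_div_mod_of_mod_ne_zero h1 h2).1)]

theorem boolSign_gridFun_update (hK : 0 < K) (a : Fin (K * K + 1) → Bool) (b : Bool) :
    boolSign (gridFun K (Function.update a (Fin.last _) b)) = gridSign K {b} a := by
  rw [boolSign_gridFun hK, Function.update_self, gridSign_update]

theorem gridSign_univ (a : Fin (K * K + 1) → Bool) :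
    gridSign K Finset.univ a = gridSign K {false} a * gridSign K {true} a := by
  simp only [gridSign, graphSign, gridEdges, Finset.prod_product, Finset.prod_singleton,
    Fintype.prod_bool]
  exact mul_comm _ _

/-- Fourier expansion of the disjunction of two bits, multiplied by the product of their signs. The
product turns the top coefficient into the constant `-1`. -/
theorem existsVar_gridFun_mul (hK : 0 < K) (a : Fin (K * K + 1) → Bool) :
    4 * (if existsVar (Fin.last _) (gridFun K) a = true then gridSign K Finset.univ a else 0) =
      3 * gridSign K Finset.univ a - gridSign K {false} a - gridSign K {true} a - 1 := by
  rw [gridSign_univ, ← boolSign_gridFun_update hK a false, ← boolSign_gridFun_update hK a true,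
    existsVar]
  generalize gridFun K (Function.update a (Fin.last _) false) = p
  generalize gridFun K (Function.update a (Fin.last _) true) = q
  cases p <;> cases q <;> norm_num [boolSign]

/-- Both sinks must be reachable, since a BDD has no node other than the source without incoming
edges. -/
theorem exists_gridFun_eq (hK : 2 ≤ K) (b : Bool) : ∃ a, gridFun K a = b := by
  cases b
  · refine ⟨fun _ => false, ?_⟩
    have h := boolSign_gridFun (K := K) (by omega) fun _ => false
    have h1 : gridSign K {false} (fun _ => false) = 1 := by
      rw [gridSign, graphSign]
      exact Finset.prod_eq_one fun _ _ => by simp [boolSign]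
    rw [h1] at h
    revert h
    cases gridFun K fun _ => false
    · simp
    · norm_num [boolSign]
  -- Only the first two cells of the first row are `1`, so exactly one row edge contributes.
  · let a : Fin (K * K + 1) → Bool := fun y => decide ((y : ℕ) ≤ 1)
    have hKK : 4 ≤ K * K := Nat.mul_le_mul hK hK
    refine ⟨a, ?_⟩
    have hlast : a (Fin.last _) = false := by
      simp only [a, Fin.val_last, decide_eq_false_iff_not]
      omega
    have h := boolSign_gridFun (K := K) (by omega) a
    rw [hlast] at h
    have ha : ∀ t < K * K, a (gridVar K false t) = decide (t ≤ 1) := by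
      intro t ht
      simp [a, gridVar_val ht]
    have h1 : gridSign K {false} a = -1 := by
      rw [gridSign, graphSign]
      refine (Finset.prod_eq_single (false, 0) ?_ ?_).trans ?_
      · rintro ⟨β, t⟩ he hne
        obtain ⟨hβ, h1, h2⟩ := mem_gridEdges.1 he
        dsimp only at hβ h1 h2 ⊢
        rw [Finset.mem_singleton] at hβ
        subst hβ
        have ht : t ≠ 0 := fun h => hne (by rw [h])
        rw [ha t h1, ha _ (succ_div_mod_of_mod_ne_zero h1 h2).1]
        have : ¬ t + 1 ≤ 1 := by omega
        simp [this, boolSign]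
      · intro h
        refine absurd (mem_gridEdges.2 ⟨by simp, by dsimp only; omega, ?_⟩) h
        rw [zero_add, Nat.mod_eq_of_lt (by omega)]
        exact one_ne_zero
      · dsimp only
        rw [ha 0 (by omega), ha 1 (by omega)]
        simp [boolSign]
    rw [h1] at h
    revert h
    cases gridFun K a
    · norm_num [boolSign]
    · simp

theorem exists_bdd_gridFun (hK : 2 ≤ K) : ∃ B : BDD (Fin (K * K + 1)), B.IsFree ∧
    B.Computes (gridFun K) ∧ B.size ≤ (K * K + 1) * 8 + 2 ∧ B.IsLayeredOfWidthLE 10 := by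
  have hcard : Fintype.card (gridProgram K).State = 8 := rfl
  have hout : ∀ b, ∃ q, (gridProgram K).Reaches (gridProgram K).length q ∧
      (gridProgram K).out q = b := by
    intro b
    obtain ⟨a, ha⟩ := exists_gridFun_eq hK b
    exact ⟨_, (gridProgram K).reaches_run a _, ha⟩
  have hM : 0 < (gridProgram K).length := Nat.succ_pos _
  refine ⟨(gridProgram K).toBDD hM hout, ?_, (gridProgram K).toBDD_computes hM hout, ?_, ?_⟩
  · refine (gridProgram K).isFree_toBDD hM hout
      -- The direction is fixed after the selector is read, and within one direction distinct times
      -- read distinct cells.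
      (fun u v => u.1 < v.1 ∧ (u.1 = 0 ∨ u.2.1 = v.2.1)) ?_ ?_ ?_
    · rintro u v w ⟨h1, h2⟩ ⟨h3, h4⟩
      refine ⟨h1.trans h3, ?_⟩
      rcases h2 with h2 | h2
      · exact .inl h2
      · rcases h4 with h4 | h4
        · omega
        · exact .inr (h2.trans h4)
    · intro t q b
      refine ⟨Nat.lt_succ_self t, ?_⟩
      cases t with
      | zero => exact .inl rfl
      | succ t => exact .inr rfl
    · rintro t q t' q' ht ht' ⟨hlt, hor⟩
      dsimp only at hlt hor
      obtain _ | t' := t'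
      · omega
      have ht'' : t' < K * K := Nat.lt_of_succ_lt_succ ht'
      obtain _ | t := t
      · exact (gridVar_ne_last ht'').symm
      · intro h
        have hq : q.1 = q'.1 := hor.resolve_left (Nat.succ_ne_zero t)
        change gridVar K q.1 t = gridVar K q'.1 t' at h
        rw [hq] at h
        have := gridVar_inj (Nat.lt_of_succ_lt_succ ht) ht'' h
        omega
  · have h := (gridProgram K).size_toBDD_le hM hout
    rwa [hcard] at h
  · have h := (gridProgram K).isLayeredOfWidthLE_toBDD hM hout
    rwa [hcard] at h

theorem NNF.IsDDNNF.one_le_of_computes_gridFun {n : ℕ} (hK : K = n + 1) (hn : 1 ≤ n)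
    {D : NNF (Fin (K * K + 1))} (hD : D.IsDDNNF)
    (hf : D.Computes (existsVar (Fin.last _) (gridFun K))) :
    1 ≤ (4 * (D.size : ℝ) ^ 2 + 5) * (2 : ℝ) ^ (-(n / 12 : ℝ)) := by
  classical
  have hK2 : 2 ≤ K := by omega
  let := D.fintypeGate
  obtain ⟨S, hrect, hex, hsub⟩ := hD.exists_partition (by rw [Fintype.card_fin]; nlinarith)
  set ε : ℝ := (2 : ℝ) ^ (-(n / 12 : ℝ)) with hε
  set X : ℝ := 2 ^ (K * K + 1) with hX
  have hXpos : 0 < X := by positivity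
  have hS : ∀ t, |∑ a with a ∈ S t, gridSign K Finset.univ a| ≤ X * ε := by
    intro t
    obtain ⟨Y, hY, hR⟩ := hrect t
    obtain ⟨β, M, hM, hc⟩ := exists_isMixedLine_of_isBalanced hK2 hY
    exact abs_sum_gridSign_le _ (Finset.mem_univ β) Y _ hR M hM (by omega)
  have h0 := abs_sum_gridSign_univ_le (β := false) (n := n) hK2 {false} (by simp) (by omega)
  have h1 := abs_sum_gridSign_univ_le (β := true) (n := n) hK2 {true} (by simp) (by omega)
  have h2 := abs_sum_gridSign_univ_le (β := true) (n := n) hK2 Finset.univ (by simp) (by omega)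
  have hpart : ∑ a, (if existsVar (Fin.last _) (gridFun K) a = true then
      gridSign K Finset.univ a else 0) = ∑ t, ∑ a with a ∈ S t, gridSign K Finset.univ a := by
    simp only [Finset.sum_filter]
    rw [Finset.sum_comm]
    refine Finset.sum_congr rfl fun a _ => ?_
    by_cases ha : D.GateTrue a D.output
    · obtain ⟨t, ht, huniq⟩ := hex a ha
      rw [if_pos ((hf a).1 ha), Finset.sum_eq_single t, if_pos ht]
      · exact fun t' _ hne => if_neg fun h => hne (huniq t' h)
      · exact fun h => absurd (Finset.mem_univ t) h
    · rw [if_neg fun h => ha ((hf a).2 h)]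
      exact (Finset.sum_eq_zero fun t _ => if_neg fun h => ha (hsub a t h)).symm
  have hle : |∑ t, ∑ a with a ∈ S t, gridSign K Finset.univ a| ≤ (D.size : ℝ) ^ 2 * (X * ε) := by
    refine (Finset.abs_sum_le_sum_abs _ _).trans ((Finset.sum_le_sum fun t _ => hS t).trans ?_)
    rw [Finset.sum_const, Finset.card_univ, Fintype.card_prod, nsmul_eq_mul, NNF.size, sq,
      Nat.cast_mul]
  have htotal : 4 * ∑ t, ∑ a with a ∈ S t, gridSign K Finset.univ a =
      3 * ∑ a, gridSign K Finset.univ a - ∑ a, gridSign K {false} a -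
        ∑ a, gridSign K {true} a - X := by
    rw [← hpart, Finset.mul_sum, Finset.sum_congr rfl fun a _ => existsVar_gridFun_mul (by omega) a]
    simp only [Finset.sum_sub_distrib, Finset.mul_sum]
    simp [hX]
  -- The `5` is `3 + 1 + 1`, from the three nonconstant terms of the expansion.
  have hfin : X * 1 ≤ X * ((4 * (D.size : ℝ) ^ 2 + 5) * ε) := by
    have e0 := abs_le.1 h0
    have e1 := abs_le.1 h1
    have e2 := abs_le.1 h2
    have e3 := abs_le.1 hle
    linarith [e0.1, e1.1, e2.2, e3.1]
  exact le_of_mul_le_mul_left hfin hXpos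

end Grid

theorem mainTheorem10 :
    ∃ (C W : ℕ) (c : ℝ) (n₀ : ℕ), 0 < c ∧
      ∀ n : ℕ, 1 ≤ n →
        ∃ (m : ℕ) (f : (Fin m → Bool) → Bool) (x : Fin m),
          m ≤ C * n ^ 2 ∧
          (∃ B : BDD (Fin m), B.IsFree ∧ B.Computes f ∧ B.size ≤ C * n ^ 2 ∧
            B.IsLayeredOfWidthLE W) ∧
          (n₀ ≤ n → ∀ D : NNF (Fin m), D.IsDDNNF → D.Computes (existsVar x f) →
            (2 : ℝ) ^ (c * (n : ℝ)) ≤ (D.size : ℝ)) := by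
  -- At `n = 1` the size bound `8 * ((n + 1) ^ 2 + 1) + 2` equals `42`. The width is eight states
  -- plus two sinks. With `y = 2 ^ (n / 48)`, the discrepancy argument gives `y ^ 4 ≤ 9 * D.size ^
  -- 2`, and `n ≥ 96` makes `y ≥ 4`, so that `9 * y ^ 2 ≤ y ^ 4`.
  refine ⟨42, 10, 1 / 48, 96, by norm_num, fun n hn => ?_⟩
  refine ⟨(n + 1) * (n + 1) + 1, gridFun (n + 1), Fin.last _, by nlinarith, ?_, ?_⟩
  · obtain ⟨B, h1, h2, h3, h4⟩ := exists_bdd_gridFun (K := n + 1) (by omega)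
    exact ⟨B, h1, h2, h3.trans (by nlinarith), h4⟩
  · intro hn' D hD hf
    have h := hD.one_le_of_computes_gridFun rfl hn hf
    have hsize : 1 ≤ D.size := by
      exact (@Fintype.card_pos_iff _ D.fintypeGate).2 ⟨D.output⟩
    have hs : (1 : ℝ) ≤ (D.size : ℝ) ^ 2 := by
      have : (1 : ℝ) ≤ D.size := by exact_mod_cast hsize
      nlinarith
    set y : ℝ := (2 : ℝ) ^ (1 / 48 * (n : ℝ)) with hy
    have hypos : 0 < y := by positivity
    have hε : (2 : ℝ) ^ (-(n / 12 : ℝ)) * y ^ 4 = 1 := by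
      rw [hy, ← Real.rpow_natCast, ← Real.rpow_mul zero_le_two, ← Real.rpow_add zero_lt_two]
      have : -(n / 12 : ℝ) + 1 / 48 * (n : ℝ) * ((4 : ℕ) : ℝ) = 0 := by
        push_cast
        ring
      rw [this, Real.rpow_zero]
    have hy2 : 4 ≤ y := by
      have h4 : (4 : ℝ) = 2 ^ (2 : ℝ) := by norm_num
      rw [h4, hy]
      refine Real.rpow_le_rpow_of_exponent_le one_le_two ?_
      have : (96 : ℝ) ≤ n := by exact_mod_cast hn'
      linarith
    have h5 : y ^ 4 ≤ 9 * (D.size : ℝ) ^ 2 := by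
      calc y ^ 4 = 1 * y ^ 4 := (one_mul _).symm
        _ ≤ ((4 * (D.size : ℝ) ^ 2 + 5) * (2 : ℝ) ^ (-(n / 12 : ℝ))) * y ^ 4 :=
          mul_le_mul_of_nonneg_right h (by positivity)
        _ = 4 * (D.size : ℝ) ^ 2 + 5 := by rw [mul_assoc, hε, mul_one]
        _ ≤ _ := by linarith
    refine le_of_sq_le_sq ?_ (Nat.cast_nonneg _)
    have h6 : 9 * y ^ 2 ≤ y ^ 4 := by
      have h7 : 9 ≤ y ^ 2 := by nlinarith
      calc 9 * y ^ 2 ≤ y ^ 2 * y ^ 2 := mul_le_mul_of_nonneg_right h7 (sq_nonneg y)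
        _ = y ^ 4 := by ring
    linarith
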